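/- **Theorem 4.2.** Fix $n\ge 0$. Let $\mathrm{Cob}(n)$ be the following category. Its objects are formally $q$-graded planar Temperley–Lieb diagrams $q^j a$ ($j\in\mathbb Z$) in a rectangle, with $n$ end points on the top and $n$ on the bottom side (closed circles allowed). Its morphisms $q^i a\to q^j b$ are the $\mathbb Z[\alpha]$-linear combinations of dotted orientable cobordisms from $a$ to $b$ in (rectangle)$\,\times[0,1]$, with identity boundary on the vertical sides, modulo isotopy (in the presence of the following relations it is equivalent to identify cobordisms that are homeomorphic relative to the boundary) and the local relations: a sphere with $0,1,2,3$ dots equals $0,1,0,\alpha$ respectively, and neck cutting (a cylinder is the sum of the two ways of replacing it by two disks of which one carries a dot). The degree of a cobordism $C\colon q^ia\to q^jb$ is $\chi(C)-n+j-i$, where every dot contributes $-2$; and $\deg\alpha=-4$. Write $a\otimes b$ for the diagram $a$ glued on top of $b$. Let $\mathrm{Kom}(n)$ consist of the complexes $(P_k,d_k\colon P_k\to P_{k+1})_{k\in\mathbb Z}$ over the category $\mathrm{Mat}(\mathrm{Cob}(n))$ of finite formal direct sums and matrices that vanish in all sufficiently negative homological degrees. Let $1$ be the identity diagram and let $e_i$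 ($0<i<n$) be the standard Temperley–Lieb generators. A complex $P\in\mathrm{Kom}(n)$ is a *universal projector* if 1. $P_k=0$ for $k<0$; for $k>0$ all summands of $P_k$ have $q$-degree $\ge 0$; and each $d_k$ is a matrix of morphisms of degree $0$; 2. $P_0\cong 1$ by an isomorphism that, like its inverse, has degree $0$; and for $k>0$ there is no object $D$ such that $P_k\cong 1\oplus D$ (by an isomorphism of any degree); 3. for all $0<i<n$ the complexes $P\otimes e_i$ and $e_i\otimes P$ are contractible, by homotopies of degree $0$. For $n=2$ write $e=e_1$, and let $t,b\colon e\to e$ be the identity cobordism with one dot on the sheet over the top arc, respectively over the bottom arc, of $e$. Let $P_2$ be given by $$(P_2)_k=\begin{cases}0&k<0\\ q^0\,1&k=0\\ q^{2k-1}e&k>0\end{cases}\qquad d_k=\begin{cases}\text{the saddle }1\to q\,e&k=0\\ t-b\colon q^{2k-1}e\to q^{2k+1}e&k>0\text{ odd}\\ t+b\colon q^{2k-1}e\to q^{2k+1}e&k>0\text{ even.}\end{cases}$$ Then $d_{k+1}\circ d_k=0$ for all $k$, and the complex $P_2\in\mathrm{Kom}(2)$ is a universal projector. -/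

import Mathlib

open CategoryTheory CategoryTheory.Limits

noncomputable section

namespace BarNatan

/-! ### Planar diagrams

A planar diagram is cut by horizontal lines, from top to bottom, into elementary layers. -/

/-- An elementary layer, read from top to bottom: `cup i` is an arc `∪` that joins the strands
`i` and `i + 1` coming from above, and `cap i` is an arc `∩` that starts two new strands, in
positions `i` and `i + 1` below. All other strands go straight down (positions count from `0`). -/
inductive Layer : Type
  | cup (i : ℕ)
  | cap (i : ℕ)
  deriving DecidableEq

/-- The number of strands that leave a word of layers at the bottom, if `m` enter at the top. -/
def width : ℕ → List Layer → ℕ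
  | m, [] => m
  | m, Layer.cup _ :: w => width (m - 2) w
  | m, Layer.cap _ :: w => width (m + 2) w

/-- The word of layers is a planar diagram with `m` end points on top and `k` at the bottom. -/
def IsTangle : ℕ → ℕ → List Layer → Prop
  | m, k, [] => m = k
  | m, k, Layer.cup i :: w => i + 2 ≤ m ∧ IsTangle (m - 2) k w
  | m, k, Layer.cap i :: w => i ≤ m ∧ IsTangle (m + 2) k w

theorem IsTangle.append {m k l : ℕ} {v w : List Layer} (hv : IsTangle m k v)
    (hw : IsTangle k l w) : IsTangle m l (v ++ w) := by
  induction v generalizing m with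
  | nil => cases hv; exact hw
  | cons L v ih => cases L <;> exact ⟨hv.1, ih hv.2⟩

theorem IsTangle.width_eq {m k : ℕ} {v : List Layer} (hv : IsTangle m k v) : width m v = k := by
  induction v generalizing m with
  | nil => exact hv
  | cons L v ih => cases L <;> exact ih hv.2

theorem width_append (m : ℕ) (v w : List Layer) : width m (v ++ w) = width (width m v) w := by
  induction v generalizing m with
  | nil => rfl
  | cons L v ih => cases L <;> exact ih _

/-- Temperley-Lieb diagrams in a rectangle with `n` end points on top and `n` at the bottom;
closed circles are allowed. -/
structure Diagram (n : ℕ) : Type where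
  word : List Layer
  isTangle : IsTangle n n word

variable {n : ℕ}

/-- The point `(l, j)` is the `j`-th strand on the `l`-th horizontal line of the diagram. -/
abbrev Diagram.Pt (a : Diagram n) : Type :=
  {z : ℕ × ℕ // z.1 ≤ a.word.length ∧ z.2 < width n (a.word.take z.1)}

/-- The two points are joined by an arc in the layer `L` between the lines `l` and `l + 1`. -/
inductive Layer.Joins (l : ℕ) : Layer → ℕ × ℕ → ℕ × ℕ → Prop
  | cup_left (i j : ℕ) (h : j < i) : Joins l (cup i) (l, j) (l + 1, j)
  | cup_turn (i : ℕ) : Joins l (cup i) (l, i) (l, i + 1)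
  | cup_right (i j : ℕ) (h : i ≤ j) : Joins l (cup i) (l, j + 2) (l + 1, j)
  | cap_left (i j : ℕ) (h : j < i) : Joins l (cap i) (l, j) (l + 1, j)
  | cap_turn (i : ℕ) : Joins l (cap i) (l + 1, i) (l + 1, i + 1)
  | cap_right (i j : ℕ) (h : i ≤ j) : Joins l (cap i) (l, j) (l + 1, j + 2)

/-- The two points of the diagram are joined by an arc within one layer. -/
def Diagram.Joined (a : Diagram n) (p q : a.Pt) : Prop :=
  ∃ (l : ℕ) (L : Layer), a.word[l]? = some L ∧ L.Joins l p.1 q.1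

/-! ### Cobordisms

A dotted cobordism in (rectangle) × [0,1] is given by a movie: a finite sequence of planar
diagrams, the horizontal slices, in which each is obtained from the one before by one elementary
change. -/

/-- The generating planar isotopies: straightening a zigzag, and exchanging the heights of two
neighbouring layers that do not meet. -/
inductive PlanarMove : List Layer → List Layer → Prop
  | zigzag (i : ℕ) : PlanarMove [.cap i, .cup (i + 1)] []
  | zagzig (i : ℕ) : PlanarMove [.cap (i + 1), .cup i] []
  | cup_cup (i j : ℕ) (h : i ≤ j) : PlanarMove [.cup i, .cup j] [.cup (j + 2), .cup i]
  | cap_cap (i j : ℕ) (h : i ≤ j) : PlanarMove [.cap i, .cap (j + 2)] [.cap j, .cap i]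
  | cup_cap (i j : ℕ) (h : j ≤ i) : PlanarMove [.cup i, .cap j] [.cap j, .cup (i + 2)]
  | cup_cap' (i j : ℕ) (h : i ≤ j) : PlanarMove [.cup i, .cap j] [.cap (j + 2), .cup i]

/-- An elementary change of a few consecutive layers: a planar isotopy, the birth or
death of a small circle, a saddle between two neighbouring vertical
strands and its inverse, or a dot on the `j`-th strand. -/
inductive Event : List Layer → List Layer → Type
  | isotopy {x y : List Layer} (h : PlanarMove x y ∨ PlanarMove y x) : Event x y
  | birth (i : ℕ) : Event [] [.cap i, .cup i]
  | death (i : ℕ) : Event [.cap i, .cup i] []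
  | saddle (i : ℕ) : Event [] [.cup i, .cap i]
  | unsaddle (i : ℕ) : Event [.cup i, .cap i] []
  | dot (j : ℕ) : Event [] []

namespace Event

variable {x y : List Layer}

/-- The number of disks minus the number of bands that the event attaches to the surface. -/
def chi : Event x y → ℤ
  | isotopy _ => 0
  | birth _ => 1
  | death _ => 1
  | saddle _ => -1
  | unsaddle _ => -1
  | dot _ => 0

/-- The number of dots of the event. -/
def dots : Event x y → ℕ
  | dot _ => 1
  | _ => 0

/-- A point (line relative to the top of `x` or `y`, strand) of the diagram before (`inl`) or after
(`inr`) the event that lies on the component of the surface where the event takes place;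
it plays no role for an isotopy. -/
def site : Event x y → (ℕ × ℕ) ⊕ (ℕ × ℕ)
  | isotopy _ => .inl (0, 0)
  | birth i => .inr (1, i)
  | death i => .inl (1, i)
  | saddle i => .inl (0, i)
  | unsaddle i => .inr (0, i)
  | dot j => .inl (0, j)

/-- A dot has to lie on one of the `m` strands. -/
def Valid (m : ℕ) : Event x y → Prop
  | dot j => j < m
  | _ => True

end Event

/-- A step of a movie: the event takes place in the slab of layers between `u` and `v`, and the
rest of the surface is a product. -/
structure Step (a b : Diagram n) : Type where
  u : List Layer
  v : List Layer
  x : List Layer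
  y : List Layer
  event : Event x y
  src : a.word = u ++ x ++ v
  tgt : b.word = u ++ y ++ v
  valid : event.Valid (width n u)

namespace Step

variable {a b : Diagram n}

/-- A point before and a point after the step that lie on the same vertical segment of the surface,
outside of the interior of the slab. -/
def Matches (s : Step a b) (p : a.Pt) (q : b.Pt) : Prop :=
  p.1.2 = q.1.2 ∧
    ((p.1.1 = q.1.1 ∧ p.1.1 ≤ s.u.length) ∨
      ∃ r : ℕ, p.1.1 = s.u.length + s.x.length + r ∧ q.1.1 = s.u.length + s.y.length + r)

/-- The event of the step takes place on the part of the surface that contains the points `A`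
before and the points `B` after the step. -/
def Meets (s : Step a b) (A : a.Pt → Prop) (B : b.Pt → Prop) : Prop :=
  match s.event.site with
  | .inl z => ∃ p : a.Pt, p.1 = (s.u.length + z.1, z.2) ∧ A p
  | .inr z => ∃ q : b.Pt, q.1 = (s.u.length + z.1, z.2) ∧ B q

/-- Put the diagram `d` on top. -/
def glueTop (d : Diagram n) {a' b' : Diagram n} (ha : a'.word = d.word ++ a.word)
    (hb : b'.word = d.word ++ b.word) (s : Step a b) : Step a' b' where
  u := d.word ++ s.u
  v := s.v
  x := s.x
  y := s.y
  event := s.event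
  src := by rw [ha, s.src]; simp
  tgt := by rw [hb, s.tgt]; simp
  valid := by rw [width_append, d.isTangle.width_eq]; exact s.valid

/-- Put the diagram `d` below. -/
def glueBot (d : Diagram n) {a' b' : Diagram n} (ha : a'.word = a.word ++ d.word)
    (hb : b'.word = b.word ++ d.word) (s : Step a b) : Step a' b' where
  u := s.u
  v := s.v ++ d.word
  x := s.x
  y := s.y
  event := s.event
  src := by rw [ha, s.src]; simp
  tgt := by rw [hb, s.tgt]; simp
  valid := s.valid

end Step

/-- Dotted cobordisms from `a` to `b`, presented as movies. -/
inductive Movie (a : Diagram n) : Diagram n → Type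
  | nil : Movie a a
  | snoc {b c : Diagram n} (m : Movie a b) (s : Step b c) : Movie a c

namespace Movie

variable {a : Diagram n}

/-- Composition of cobordisms. -/
def comp {b : Diagram n} (m : Movie a b) : {c : Diagram n} → Movie b c → Movie a c
  | _, nil => m
  | _, snoc m' s => snoc (comp m m') s

theorem nil_comp {b : Diagram n} (m : Movie a b) : comp nil m = m := by
  induction m with
  | nil => rfl
  | snoc m s ih => simp only [comp, ih]

theorem comp_assoc {b c d : Diagram n} (m₁ : Movie a b) (m₂ : Movie b c) (m₃ : Movie c d) :
    comp (comp m₁ m₂) m₃ = comp m₁ (comp m₂ m₃) := by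
  induction m₃ with
  | nil => rfl
  | snoc m s ih => simp only [comp, ih]

/-- The movie with one step. -/
def ofStep {b : Diagram n} (s : Step a b) : Movie a b := snoc nil s

/-- The points of the surface swept out by a movie: the points of all its slices. -/
def Pt : {b : Diagram n} → Movie a b → Type
  | _, nil => a.Pt
  | c, snoc m _ => Pt m ⊕ c.Pt

/-- The points of the first slice. -/
def first : {b : Diagram n} → (m : Movie a b) → a.Pt → m.Pt
  | _, nil, p => p
  | _, snoc m _, p => Sum.inl (first m p)

/-- The points of the last slice. -/
def last : {b : Diagram n} → (m : Movie a b) → b.Pt → m.Pt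
  | _, nil, p => p
  | _, snoc _ _, p => Sum.inr p

/-- Two points of the surface are joined within a slice, or between two consecutive slices. -/
def Joined : {b : Diagram n} → (m : Movie a b) → m.Pt → m.Pt → Prop
  | _, nil => a.Joined
  | c, snoc m s => fun (p q : m.Pt ⊕ c.Pt) =>
      match p, q with
      | .inl p, .inl q => Joined m p q
      | .inl p, .inr q => ∃ r, last m r = p ∧ s.Matches r q
      | .inr _, .inl _ => False
      | .inr p, .inr q => c.Joined p q

/-- The connected components of the surface. -/
def Component {b : Diagram n} (m : Movie a b) : Type := Quot m.Joined

open Classical in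
/-- The relative Euler characteristic of the part of the surface that contains the points `S`:
the Euler characteristic minus that of the intersection with the first slice. -/
def chi : {b : Diagram n} → (m : Movie a b) → (m.Pt → Prop) → ℤ
  | _, nil, _ => 0
  | _, snoc m s, S =>
      chi m (fun p => S (Sum.inl p)) +
        if s.Meets (fun p => S (Sum.inl (last m p))) (fun q => S (Sum.inr q)) then s.event.chi else 0

open Classical in
/-- The number of dots on the part of the surface that contains the points `S`. -/
def dots : {b : Diagram n} → (m : Movie a b) → (m.Pt → Prop) → ℕ
  | _, nil, _ => 0
  | _, snoc m s, S =>
      dots m (fun p => S (Sum.inl p)) +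
        if s.Meets (fun p => S (Sum.inl (last m p))) (fun q => S (Sum.inr q)) then s.event.dots else 0

/-- Two dotted cobordisms with the same boundary are equivalent if there is a bijection between
their components that is compatible with the boundary and preserves the Euler characteristic
(hence the genus) and the number of dots; by the classification of surfaces this says that they
are homeomorphic relative to the boundary, as abstract dotted surfaces. Isotopic cobordisms are
equivalent in this sense, and cobordisms that are equivalent in this sense become equal
when neck cutting and the sphere relations are imposed on isotopy classes. -/
def Equivalent {b : Diagram n} (m m' : Movie a b) : Prop :=
  ∃ φ : m.Component ≃ m'.Component,
    (∀ p : a.Pt, φ (Quot.mk _ (m.first p)) = Quot.mk _ (m'.first p)) ∧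
    (∀ q : b.Pt, φ (Quot.mk _ (m.last q)) = Quot.mk _ (m'.last q)) ∧
    (∀ c : m.Component, m.chi (fun p => Quot.mk _ p = c) = m'.chi (fun p => Quot.mk _ p = φ c)) ∧
    (∀ c : m.Component, m.dots (fun p => Quot.mk _ p = c) = m'.dots (fun p => Quot.mk _ p = φ c))

/-- The topological degree `χ - n` of a cobordism, where a dot counts `-2`. (The first slice
contributes its `n` arcs, of Euler characteristic `1` each, to `χ`.) -/
def degree : {b : Diagram n} → Movie a b → ℤ
  | _, nil => 0
  | _, snoc m s => degree m + s.event.chi - 2 * (s.event.dots : ℤ)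

end Movie

namespace Diagram

/-- The diagram `a ⊗ b`: `a` on top of `b`. -/
def tensor (a b : Diagram n) : Diagram n := ⟨a.word ++ b.word, a.isTangle.append b.isTangle⟩

end Diagram

namespace Movie

variable {a : Diagram n}

/-- Glue the identity cobordism of `d` on top. -/
def glueTop (d : Diagram n) : {b : Diagram n} → Movie a b → Movie (d.tensor a) (d.tensor b)
  | _, nil => nil
  | _, snoc m s => snoc (glueTop d m) (s.glueTop d rfl rfl)

/-- Glue the identity cobordism of `d` below. -/
def glueBot (d : Diagram n) : {b : Diagram n} → Movie a b → Movie (a.tensor d) (b.tensor d)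
  | _, nil => nil
  | _, snoc m s => snoc (glueBot d m) (s.glueBot d rfl rfl)

theorem glueTop_comp (d : Diagram n) {b c : Diagram n} (m : Movie a b) (m' : Movie b c) :
    glueTop d (comp m m') = comp (glueTop d m) (glueTop d m') := by
  induction m' with
  | nil => rfl
  | snoc m s ih => simp only [comp, glueTop, ih]

theorem glueBot_comp (d : Diagram n) {b c : Diagram n} (m : Movie a b) (m' : Movie b c) :
    glueBot d (comp m m') = comp (glueBot d m) (glueBot d m') := by
  induction m' with
  | nil => rfl
  | snoc m s ih => simp only [comp, glueBot, ih]

end Movie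

/-! ### The category `Cob n` -/

/-- The formally `q`-graded diagram `q ^ deg` `diagram`. -/
structure GradedDiagram (n : ℕ) : Type where
  diagram : Diagram n
  deg : ℤ

instance (n : ℕ) : Category (GradedDiagram n) where
  Hom X Y := Movie X.diagram Y.diagram
  id _ := Movie.nil
  comp m m' := Movie.comp m m'
  id_comp m := Movie.nil_comp m
  comp_id _ := rfl
  assoc m₁ m₂ m₃ := Movie.comp_assoc m₁ m₂ m₃

/-- The graded diagram `X` glued on top. -/
def gradedTop (X : GradedDiagram n) : GradedDiagram n ⥤ GradedDiagram n where
  obj Y := ⟨X.diagram.tensor Y.diagram, X.deg + Y.deg⟩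
  map m := Movie.glueTop X.diagram m
  map_id _ := rfl
  map_comp m m' := Movie.glueTop_comp X.diagram m m'

/-- The graded diagram `X` glued below. -/
def gradedBot (X : GradedDiagram n) : GradedDiagram n ⥤ GradedDiagram n where
  obj Y := ⟨Y.diagram.tensor X.diagram, Y.deg + X.deg⟩
  map m := Movie.glueBot X.diagram m
  map_id _ := rfl
  map_comp m m' := Movie.glueBot_comp X.diagram m m'

/-- The base ring `ℤ[α]`. -/
abbrev R : Type := Polynomial ℤ

/-- The parameter `α`. -/
abbrev alpha : R := Polynomial.X

/-- Formal `ℤ[α]`-linear combinations of movies. -/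
abbrev PreCob (n : ℕ) : Type := Free R (GradedDiagram n)

/-- A cobordism as a morphism between two graded diagrams. -/
def lin {a b : Diagram n} (p q : ℤ) (m : Movie a b) :
    (Free.of R (⟨a, p⟩ : GradedDiagram n) ⟶ Free.of R (⟨b, q⟩ : GradedDiagram n)) :=
  (Free.embedding R (GradedDiagram n)).map (X := ⟨a, p⟩) (Y := ⟨b, q⟩) m

/-- The linear extension of `gradedTop`. -/
def preTop (X : GradedDiagram n) : PreCob n ⥤ PreCob n :=
  Free.lift R (gradedTop X ⋙ Free.embedding R (GradedDiagram n))

/-- The linear extension of `gradedBot`. -/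
def preBot (X : GradedDiagram n) : PreCob n ⥤ PreCob n :=
  Free.lift R (gradedBot X ⋙ Free.embedding R (GradedDiagram n))

instance (X : GradedDiagram n) : (preTop X).Additive :=
  inferInstanceAs (Free.lift R _).Additive

instance (X : GradedDiagram n) : (preBot X).Additive :=
  inferInstanceAs (Free.lift R _).Additive

/-- A place in a diagram where a small circle can be inserted. -/
structure CircleSite (n : ℕ) : Type where
  u : List Layer
  v : List Layer
  i : ℕ
  isTangle : IsTangle n n (u ++ v)
  isTangle' : IsTangle n n (u ++ [.cap i, .cup i] ++ v)

namespace CircleSite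

variable (s : CircleSite n)

/-- The diagram without the circle. -/
def out : Diagram n := ⟨s.u ++ s.v, s.isTangle⟩

/-- The diagram with the circle. -/
def circ : Diagram n := ⟨s.u ++ [.cap s.i, .cup s.i] ++ s.v, s.isTangle'⟩

/-- The circle is born. -/
def birth : Movie s.out s.circ :=
  .ofStep ⟨s.u, s.v, [], _, .birth s.i, by simp [out], rfl, trivial⟩

/-- The circle dies. -/
def death : Movie s.circ s.out :=
  .ofStep ⟨s.u, s.v, _, [], .death s.i, rfl, by simp [out], trivial⟩

theorem lt_width {m k i : ℕ} {u v : List Layer} (h : IsTangle m k (u ++ .cap i :: v)) :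
    i < width m (u ++ [.cap i]) := by
  induction u generalizing m with
  | nil => have := h.1; simp only [List.nil_append, width]; omega
  | cons L u ih => cases L <;> exact ih h.2

/-- A dot on the circle. -/
def dot : Movie s.circ s.circ :=
  .ofStep ⟨s.u ++ [.cap s.i], .cup s.i :: s.v, [], [], .dot s.i, by simp [circ], by simp [circ],
    lt_width (v := .cup s.i :: s.v) (by simpa using s.isTangle')⟩

end CircleSite

/-- The relations in `Cob n`: the smallest linear congruence, stable under composition and under
gluing of diagrams on top and below, that identifies equivalent cobordisms and contains the sphere
relations and neck cutting. -/
inductive Rel (n : ℕ) : ∀ ⦃X Y : PreCob n⦄, (X ⟶ Y) → (X ⟶ Y) → Prop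
  | equivalent {a b : Diagram n} (p q : ℤ) (m m' : Movie a b) (h : m.Equivalent m') :
      Rel n (lin p q m) (lin p q m')
  | sphere (s : CircleSite n) (p q : ℤ) : Rel n (lin p q (s.birth.comp s.death)) 0
  | sphere_dot (s : CircleSite n) (p q : ℤ) :
      Rel n (lin p q (s.birth.comp (s.dot.comp s.death))) (lin p q .nil)
  | sphere_dot_dot (s : CircleSite n) (p q : ℤ) :
      Rel n (lin p q (s.birth.comp (s.dot.comp (s.dot.comp s.death)))) 0
  | sphere_dot_dot_dot (s : CircleSite n) (p q : ℤ) :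
      Rel n (lin p q (s.birth.comp (s.dot.comp (s.dot.comp (s.dot.comp s.death)))))
        (alpha • lin p q .nil)
  | neck (s : CircleSite n) (p q : ℤ) :
      Rel n (lin p q (.nil : Movie s.circ s.circ))
        (lin p q (s.death.comp (s.birth.comp s.dot)) + lin p q (s.dot.comp (s.death.comp s.birth)))
  | refl {X Y : PreCob n} (f : X ⟶ Y) : Rel n f f
  | symm {X Y : PreCob n} {f g : X ⟶ Y} : Rel n f g → Rel n g f
  | trans {X Y : PreCob n} {f g h : X ⟶ Y} : Rel n f g → Rel n g h → Rel n f h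
  | add {X Y : PreCob n} {f g f' g' : X ⟶ Y} : Rel n f g → Rel n f' g' → Rel n (f + f') (g + g')
  | smul {X Y : PreCob n} (r : R) {f g : X ⟶ Y} : Rel n f g → Rel n (r • f) (r • g)
  | comp_left {X Y Z : PreCob n} (f : X ⟶ Y) {g g' : Y ⟶ Z} : Rel n g g' → Rel n (f ≫ g) (f ≫ g')
  | comp_right {X Y Z : PreCob n} {f f' : X ⟶ Y} (g : Y ⟶ Z) : Rel n f f' → Rel n (f ≫ g) (f' ≫ g)
  | glueTop {X Y : PreCob n} (D : GradedDiagram n) {f g : X ⟶ Y} :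
      Rel n f g → Rel n ((preTop D).map f) ((preTop D).map g)
  | glueBot {X Y : PreCob n} (D : GradedDiagram n) {f g : X ⟶ Y} :
      Rel n f g → Rel n ((preBot D).map f) ((preBot D).map g)

/-- The relations, as a relation on the morphisms of `PreCob n`. -/
def rel (n : ℕ) : HomRel (PreCob n) := fun _ _ f g => Rel n f g

instance (n : ℕ) : Congruence (rel n) where
  equivalence := ⟨Rel.refl, Rel.symm, Rel.trans⟩
  comp_left f _ _ h := Rel.comp_left f h
  comp_right g h := Rel.comp_right g h

/-- The category of `q`-graded diagrams and `ℤ[α]`-linear combinations (of arbitrary degree) of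
dotted cobordisms modulo the local relations. -/
abbrev Cob (n : ℕ) : Type := Quotient (rel n)

instance (n : ℕ) : Preadditive (Cob n) :=
  Quotient.preadditive _ fun _ _ _ _ _ _ h h' => Rel.add h h'

instance (n : ℕ) : (Quotient.functor (rel n)).Additive where
  map_add := rfl

namespace Cob

/-- The object `q ^ j a` of `Cob n`. -/
def obj (a : Diagram n) (j : ℤ) : Cob n :=
  (Quotient.functor (rel n)).obj (Free.of R ⟨a, j⟩)

/-- The diagram of an object. -/
def diagram (X : Cob n) : Diagram n := GradedDiagram.diagram X.as

/-- The `q`-degree of an object. -/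
def deg (X : Cob n) : ℤ := GradedDiagram.deg X.as

/-- The morphism `r [m]`, for a cobordism `m` and a scalar `r`. -/
def ofMovie {X Y : Cob n} (r : R) (m : Movie X.diagram Y.diagram) : X ⟶ Y :=
  (Quotient.functor (rel n)).map (X := X.as) (Y := Y.as)
    (r • lin X.deg Y.deg m)

/-- The morphisms of degree `0`: sums of terms `± α ^ k [m]` with
`deg_t m + deg_q m + k deg α = 0`, where `deg_q m` is the difference of the `q`-degrees and
`deg α = -4`. -/
def degreeZero (X Y : Cob n) : AddSubgroup (X ⟶ Y) :=
  AddSubgroup.closure {f | ∃ (k : ℕ) (m : Movie X.diagram Y.diagram),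
    m.degree + (Y.deg - X.deg) - 4 * (k : ℤ) = 0 ∧ f = ofMovie (alpha ^ k) m}

/-- The functor `D ⊗ -`: glue `D` on top. -/
def tensorLeft (D : GradedDiagram n) : Cob n ⥤ Cob n :=
  CategoryTheory.Quotient.lift _ (preTop D ⋙ Quotient.functor (rel n))
    fun _ _ _ _ h => CategoryTheory.Quotient.sound _ (Rel.glueTop D h)

/-- The functor `- ⊗ D`: glue `D` below. -/
def tensorRight (D : GradedDiagram n) : Cob n ⥤ Cob n :=
  CategoryTheory.Quotient.lift _ (preBot D ⋙ Quotient.functor (rel n))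
    fun _ _ _ _ h => CategoryTheory.Quotient.sound _ (Rel.glueBot D h)

instance (D : GradedDiagram n) : (tensorLeft D).Additive where
  map_add {_ _ f g} := by
    induction f using Quot.inductionOn with | _ f
    induction g using Quot.inductionOn with | _ g
    exact congrArg (Quotient.functor (rel n)).map ((preTop D).map_add)

instance (D : GradedDiagram n) : (tensorRight D).Additive where
  map_add {_ _ f g} := by
    induction f using Quot.inductionOn with | _ f
    induction g using Quot.inductionOn with | _ g
    exact congrArg (Quotient.functor (rel n)).map ((preBot D).map_add)

end Cob

instance mapMat_additive {C D : Type*} [Category.{0} C] [Preadditive C] [Category.{0} D] [Preadditive D]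
    (F : C ⥤ D) [F.Additive] : F.mapMat_.Additive where
  map_add {_ _ f g} := by
    ext i j
    exact F.map_add

instance (n : ℕ) : HasBinaryBiproducts (Mat_ (Cob n)) :=
  hasBinaryBiproducts_of_finite_biproducts _

/-! ### Chain complexes and universal projectors -/

/-- All entries of the matrix have degree `0`. -/
def IsDegreeZero {M N : Mat_ (Cob n)} (f : M ⟶ N) : Prop :=
  ∀ i j, f i j ∈ Cob.degreeZero (M.X i) (N.X j)

/-- Cochain complexes over `Mat (Cob n)`; the differential raises the homological degree. -/
abbrev Cpx (n : ℕ) : Type 1 := CochainComplex (Mat_ (Cob n)) ℤ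

/-- The condition that defines the objects of `Kom n`: the complex is bounded below. -/
def InKom (P : Cpx n) : Prop := ∃ N : ℤ, ∀ k < N, IsZero (P.X k)

/-- `P ≃ 0`, by a homotopy of degree `0`. -/
def Contractible (P : Cpx n) : Prop :=
  ∃ h : Homotopy (𝟙 P) 0, ∀ i j, IsDegreeZero (h.hom i j)

/-- `D ⊗ P`, where the diagram `D` is placed in homological degree `0`. -/
def tensorLeft (D : Diagram n) (P : Cpx n) : Cpx n :=
  ((Cob.tensorLeft ⟨D, 0⟩).mapMat_.mapHomologicalComplex _).obj P

/-- `P ⊗ D`, where the diagram `D` is placed in homological degree `0`. -/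
def tensorRight (P : Cpx n) (D : Diagram n) : Cpx n :=
  ((Cob.tensorRight ⟨D, 0⟩).mapMat_.mapHomologicalComplex _).obj P

/-- The identity diagram: `n` vertical strands. -/
def one (n : ℕ) : Diagram n := ⟨[], rfl⟩

/-- The generator that connects the strands `i` and `i + 1` (counted from `0`) on top, and also at
the bottom. -/
def e (i : ℕ) (h : i + 2 ≤ n) : Diagram n :=
  ⟨[.cup i, .cap i], by simp only [IsTangle]; omega⟩

/-- The object `q ^ j a` of `Mat (Cob n)`. -/
def shifted (a : Diagram n) (j : ℤ) : Mat_ (Cob n) := (Mat_.embedding (Cob n)).obj (Cob.obj a j)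

/-- Universal projectors. Isomorphisms and homotopies are of degree `0` where their existence is
required, and of any degree where it is excluded. -/
structure IsUniversalProjector (P : Cpx n) : Prop where
  inKom : InKom P
  isZero_of_neg : ∀ k < 0, IsZero (P.X k)
  deg_nonneg : ∀ k > 0, ∀ i, 0 ≤ ((P.X k).X i).deg
  d_degreeZero : ∀ k : ℤ, IsDegreeZero (P.d k (k + 1))
  zero_iso : ∃ f : P.X 0 ≅ shifted (one n) 0, IsDegreeZero f.hom ∧ IsDegreeZero f.inv
  not_iso : ∀ k > 0, ∀ D : Mat_ (Cob n), ¬ Nonempty (P.X k ≅ shifted (one n) 0 ⊞ D)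
  tensor_e : ∀ (i : ℕ) (h : i + 2 ≤ n), Contractible (tensorRight P (e i h))
  e_tensor : ∀ (i : ℕ) (h : i + 2 ≤ n), Contractible (tensorLeft (e i h) P)

/-! ### The complex `P₂` -/

/-- The diagram `e₁` with two strands. -/
def e₁ : Diagram 2 := e 0 le_rfl

/-- The saddle from the identity diagram to `e₁`. -/
def saddle : Movie (one 2) e₁ :=
  .ofStep ⟨[], [], [], _, .saddle 0, rfl, rfl, trivial⟩

/-- The dot on the top arc of `e₁`. -/
def dotTop : Movie e₁ e₁ :=
  .ofStep ⟨[], e₁.word, [], [], .dot 0, rfl, rfl, Nat.zero_lt_two⟩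

/-- The dot on the bottom arc of `e₁`. -/
def dotBot : Movie e₁ e₁ :=
  .ofStep ⟨e₁.word, [], [], [], .dot 0, rfl, rfl, Nat.zero_lt_two⟩

/-- A cobordism as a `1 × 1` matrix. -/
def mat {a b : Diagram n} (p q : ℤ) (m : Movie a b) : shifted a p ⟶ shifted b q :=
  (Mat_.embedding (Cob n)).map (Cob.ofMovie (X := Cob.obj a p) (Y := Cob.obj b q) 1 m)

/-- The chain groups: the identity diagram in degree `0`, and `q ^ (2k-1) e₁` in degree `k > 0`. -/
def P₂X : ℤ → Mat_ (Cob 2)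
  | .ofNat 0 => shifted (one 2) 0
  | .ofNat (k + 1) => shifted e₁ (2 * ((k : ℤ) + 1) - 1)
  | .negSucc _ => ⟨Empty, Empty.elim⟩

/-- The differential: the saddle in degree `0`, the dot on top minus the dot at the bottom in odd
degrees `k > 0`, and their sum in even degrees `k > 0`. -/
def P₂d : (k : ℤ) → (P₂X k ⟶ P₂X (k + 1))
  | .ofNat 0 => mat 0 _ saddle
  | .ofNat (k + 1) =>
      if Odd (k + 1) then mat _ _ dotTop - mat _ _ dotBot else mat _ _ dotTop + mat _ _ dotBot
  | .negSucc _ => 0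

end BarNatan

end

/-!
Write `e` for `e₁`. The diagram `e ⊗ e` is `e` together with a circle. Cutting the neck of the
cylinder over that circle writes the identity of `e ⊗ e` as a sum of two cobordisms in which the
circle dies and is born again, with a dot before or after. Modulo the sign changes of the
differential these two terms are `d ≫ h + h ≫ d`, where `h` is the death of the circle in the lowest
degree and the death followed by the birth in all others.

To see that `1` is not a summand of `q ^ j e`, colour the components of a cobordism by the two
idempotents of a semisimple specialization of the Frobenius algebra `ℤ[α][x] / (x² - α)`; the state
sum is invariant under all relations. On the identity of `1` it takes a nonzero value at a colouring
that distinguishes the two strands, but a cobordism that factors through `e` forces them to have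
equal colours.
-/

noncomputable section

namespace BarNatan

variable {n : ℕ}

/-! ### The state sum -/

instance : Fact (Nat.Prime 17) := ⟨by norm_num⟩

/-- The value of a dot on a component of colour `c`. The colours are the idempotents `(1 ± x) / 2`
of the Frobenius algebra `𝔽₁₇[x] / (x² - 1)`, the specialization at `α = 1`, and the dot is
multiplication by `x`. -/
def dotValue (c : Bool) : ZMod 17 := if c then 1 else -1

/-- The value of a disk of colour `c`, a square root of the counit `± 1 / 2` of the idempotent `c`.
The prime `17` is chosen because both square roots exist in `𝔽₁₇`. -/
def diskValue (c : Bool) : ZMod 17 := if c then 3 else 5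

theorem diskValue_ne_zero (c : Bool) : diskValue c ≠ 0 := by
  revert c; decide

/-- The contribution to the state sum of a component of colour `c` with relative Euler
characteristic `χ` and `d` dots. -/
def weight (χ : ℤ) (d : ℕ) (c : Bool) : ZMod 17 := diskValue c ^ χ * dotValue c ^ d

theorem weight_zero (c : Bool) : weight 0 0 c = 1 := by simp [weight]

theorem weight_add (χ χ' : ℤ) (d d' : ℕ) (c : Bool) :
    weight (χ + χ') (d + d') c = weight χ d c * weight χ' d' c := by
  simp only [weight, zpow_add₀ (diskValue_ne_zero c), pow_add]
  ring

instance Diagram.finite_pt (a : Diagram n) : Finite a.Pt :=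
  Finite.of_injective
    (β := Σ l : Fin (a.word.length + 1), Fin (width n (a.word.take l)))
    (fun p => ⟨⟨p.1.1, Nat.lt_succ_of_le p.2.1⟩, ⟨p.1.2, p.2.2⟩⟩) <| by
      rintro ⟨⟨l, j⟩, hl, hj⟩ ⟨⟨l', j'⟩, hl', hj'⟩ h
      obtain ⟨rfl, h⟩ : l = l' ∧ _ := by simpa using h
      simpa using h

instance Movie.finite_pt {a b : Diagram n} (m : Movie a b) : Finite m.Pt := by
  induction m with
  | nil => exact a.finite_pt
  | snoc m s ih => exact inferInstanceAs (Finite (m.Pt ⊕ _))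

instance Movie.finite_component {a b : Diagram n} (m : Movie a b) : Finite m.Component :=
  inferInstanceAs (Finite (Quot m.Joined))

instance Movie.fintype_component {a b : Diagram n} (m : Movie a b) : Fintype m.Component :=
  Fintype.ofFinite _

/-- Colourings of the components of a diagram. -/
abbrev Diagram.Coloring (a : Diagram n) : Type :=
  {σ : a.Pt → Bool // ∀ p q, a.Joined p q → σ p = σ q}

/-- Colourings of the components of a movie. -/
abbrev Movie.Coloring {a b : Diagram n} (m : Movie a b) : Type :=
  {κ : m.Pt → Bool // ∀ p q, m.Joined p q → κ p = κ q}

instance (a : Diagram n) : Fintype a.Coloring := Fintype.ofFinite _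

instance {a b : Diagram n} (m : Movie a b) : Fintype m.Coloring := Fintype.ofFinite _

open Classical in
instance (a : Diagram n) : DecidableEq a.Coloring := inferInstance

namespace Step

variable {a b : Diagram n} (s : Step a b)

theorem meets_cases :
    (∀ A B, ¬ s.Meets A B) ∨ (∃ p, ∀ A B, s.Meets A B ↔ A p) ∨ ∃ q, ∀ A B, s.Meets A B ↔ B q := by
  have point {c : Diagram n} (z : ℕ × ℕ) : (∀ C : c.Pt → Prop, ¬ ∃ p, p.1 = z ∧ C p) ∨
      ∃ p, ∀ C : c.Pt → Prop, (∃ p', p'.1 = z ∧ C p') ↔ C p := by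
    by_cases h : ∃ p : c.Pt, p.1 = z
    · obtain ⟨p, rfl⟩ := h
      exact .inr ⟨p, fun C => ⟨fun ⟨p', hp', h⟩ => Subtype.ext hp' ▸ h, fun h => ⟨p, rfl, h⟩⟩⟩
    · exact .inl fun C ⟨p, hp, _⟩ => h ⟨p, hp⟩
  unfold Meets
  rcases s.event.site with z | z
  · exact (point _).imp (fun h A _ => h A) fun ⟨p, h⟩ => .inl ⟨p, fun A _ => h A⟩
  · exact (point _).imp (fun h _ B => h B) fun ⟨p, h⟩ => .inr ⟨p, fun _ B => h B⟩

open Classical in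
/-- The weight of the event of a step, between two coloured slices: the product has at most one
factor other than `1`, for the colour of the component where the event takes place. -/
def colorWeight (σ : a.Pt → Bool) (τ : b.Pt → Bool) : ZMod 17 :=
  ∏ c : Bool, if s.Meets (fun p => σ p = c) (fun q => τ q = c) then
    weight s.event.chi s.event.dots c else 1

open Classical in
theorem colorWeight_comp {I : Type} [Fintype I] (f : a.Pt → I) (f' : b.Pt → I) (g : I → Bool) :
    s.colorWeight (g ∘ f) (g ∘ f') =
      ∏ i, if s.Meets (fun p => f p = i) (fun q => f' q = i) then
        weight s.event.chi s.event.dots (g i) else 1 := by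
  unfold colorWeight
  rcases s.meets_cases with h | ⟨p, h⟩ | ⟨p, h⟩ <;> simp [h]

open Classical in
/-- The matrix of a step. -/
def matrix : Matrix a.Coloring b.Coloring (ZMod 17) := fun σ τ =>
  if ∀ p q, s.Matches p q → σ.1 p = τ.1 q then s.colorWeight σ.1 τ.1 else 0

end Step

namespace Movie

variable {a b : Diagram n}

/-- The state sum of a movie, as a matrix whose indices are the colourings of the two boundary
diagrams. -/
def matrix : {b : Diagram n} → Movie a b → Matrix a.Coloring b.Coloring (ZMod 17)
  | _, nil => 1
  | _, snoc m s => matrix m * s.matrix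

theorem matrix_ofStep (s : Step a b) : (ofStep s).matrix = s.matrix := Matrix.one_mul _

theorem matrix_comp {b c : Diagram n} (m : Movie a b) (m' : Movie b c) :
    (m.comp m').matrix = m.matrix * m'.matrix := by
  induction m' with
  | nil => simp [comp, matrix]
  | snoc m s ih => simp only [comp, matrix, ih, Matrix.mul_assoc]

/-- The weight of a coloured movie. -/
def colorWeight : {b : Diagram n} → (m : Movie a b) → (m.Pt → Bool) → ZMod 17
  | _, nil, _ => 1
  | _, snoc m s, κ =>
      colorWeight m (fun p => κ (Sum.inl p)) *
        s.colorWeight (fun p => κ (Sum.inl (last m p))) (fun q => κ (Sum.inr q))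

theorem colorWeight_comp {I : Type} [Fintype I] (g : I → Bool) {b : Diagram n} (m : Movie a b)
    (f : m.Pt → I) :
    m.colorWeight (g ∘ f) =
      ∏ i, weight (m.chi fun p => f p = i) (m.dots fun p => f p = i) (g i) := by
  induction m with
  | nil => simp [colorWeight, chi, dots, weight_zero]
  | snoc m s ih =>
    have h := ih (fun p => f (Sum.inl p))
    have h' := s.colorWeight_comp (fun p => f (Sum.inl (last m p))) (fun q => f (Sum.inr q)) g
    simp only [Function.comp_def] at h h' ⊢
    simp only [colorWeight, chi, dots, weight_add, Finset.prod_mul_distrib, h, h']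
    congr 1
    refine Finset.prod_congr rfl fun i _ => ?_
    split_ifs <;> simp [weight_zero]

theorem joined_first {b : Diagram n} (m : Movie a b) {p q : a.Pt} (h : a.Joined p q) :
    m.Joined (m.first p) (m.first q) := by
  induction m with
  | nil => exact h
  | snoc _ _ ih => exact ih

theorem joined_last {b : Diagram n} (m : Movie a b) {p q : b.Pt} (h : b.Joined p q) :
    m.Joined (m.last p) (m.last q) := by
  cases m <;> exact h

namespace Coloring

/-- The restriction of a colouring to the first slice. -/
def first {m : Movie a b} (κ : m.Coloring) : a.Coloring :=
  ⟨fun p => κ.1 (m.first p), fun _ _ h => κ.2 _ _ (m.joined_first h)⟩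

/-- The restriction of a colouring to the last slice. -/
def last {m : Movie a b} (κ : m.Coloring) : b.Coloring :=
  ⟨fun p => κ.1 (m.last p), fun _ _ h => κ.2 _ _ (m.joined_last h)⟩

variable {c : Diagram n} {m : Movie a b} {s : Step b c}

/-- The restriction of a colouring to the movie without its last step. -/
def init (κ : (m.snoc s).Coloring) : m.Coloring :=
  ⟨fun p => κ.1 (.inl p), fun p q h => κ.2 (.inl p) (.inl q) h⟩

theorem init_last_eq (κ : (m.snoc s).Coloring) {p : b.Pt} {q : c.Pt} (h : s.Matches p q) :
    κ.init.last.1 p = κ.last.1 q :=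
  κ.2 (.inl (m.last p)) (.inr q) ⟨p, rfl, h⟩

theorem init_last_injective :
    Function.Injective fun κ : (m.snoc s).Coloring => (κ.init, κ.last) := by
  intro κ κ' h
  obtain ⟨h₁, h₂⟩ := Prod.ext_iff.1 h
  ext (p | q)
  · exact congrFun (congrArg Subtype.val h₁) p
  · exact congrFun (congrArg Subtype.val h₂) q

theorem exists_snoc (κ : m.Coloring) (τ : c.Coloring)
    (h : ∀ p q, s.Matches p q → κ.last.1 p = τ.1 q) :
    ∃ κ' : (m.snoc s).Coloring, (κ'.init, κ'.last) = (κ, τ) := by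
  refine ⟨⟨Sum.elim κ.1 τ.1, ?_⟩, rfl⟩
  rintro (p | p) (q | q) hpq
  · exact κ.2 p q hpq
  · obtain ⟨r, rfl, hr⟩ := hpq
    exact h r q hr
  · exact hpq.elim
  · exact τ.2 p q hpq

end Coloring

theorem colorWeight_snoc {c : Diagram n} {m : Movie a b} {s : Step b c}
    (κ : (m.snoc s).Coloring) : (m.snoc s).colorWeight κ.1 =
      m.colorWeight κ.init.1 * s.matrix κ.init.last κ.last := by
  rw [Step.matrix, if_pos fun _ _ => κ.init_last_eq]
  rfl

theorem matrix_apply {b : Diagram n} (m : Movie a b) (σ : a.Coloring) (τ : b.Coloring) :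
    m.matrix σ τ =
      ∑ κ : m.Coloring, if κ.first = σ ∧ κ.last = τ then m.colorWeight κ.1 else 0 := by
  induction m with
  | nil =>
    refine .trans ?_ (Finset.sum_eq_single (M := ZMod 17) (σ : (nil : Movie a a).Coloring)
      (fun κ _ hκ => if_neg fun h => hκ h.1) fun h => (h (Finset.mem_univ _)).elim).symm
    rw [matrix, Matrix.one_apply]
    exact if_congr ⟨fun h => ⟨rfl, h⟩, fun h => h.2⟩ rfl rfl
  | @snoc b c m s ih =>
    calc (m.snoc s).matrix σ τ
      _ = ∑ ρ, m.matrix σ ρ * s.matrix ρ τ := Matrix.mul_apply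
      _ = ∑ κ : m.Coloring,
            if κ.first = σ then m.colorWeight κ.1 * s.matrix κ.last τ else 0 := by
        simp only [ih, Finset.sum_mul]
        rw [Finset.sum_comm]
        simp [ite_and, ite_mul]
      _ = ∑ p : m.Coloring × c.Coloring, if p.1.first = σ ∧ p.2 = τ then
            m.colorWeight p.1.1 * s.matrix p.1.last p.2 else 0 := by
        simp [Fintype.sum_prod_type, ite_and]
      _ = ∑ κ : (m.snoc s).Coloring,
            if κ.first = σ ∧ κ.last = τ then (m.snoc s).colorWeight κ.1 else 0 := by
        refine (Fintype.sum_of_injective _ Coloring.init_last_injective _ _ ?_ ?_).symm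
        · rintro ⟨κ, τ'⟩ hκ
          have : s.matrix κ.last τ' = 0 := if_neg fun h => hκ (Coloring.exists_snoc κ τ' h)
          simp [this]
        · intro κ
          rw [colorWeight_snoc]
          rfl

/-- The component of a point. -/
def component (m : Movie a b) (p : m.Pt) : m.Component := Quot.mk _ p

/-- A colouring is the same as a function on the components. -/
def coloringEquiv (m : Movie a b) : (m.Component → Bool) ≃ m.Coloring where
  toFun κ := ⟨κ ∘ m.component, fun _ _ h => congrArg κ (Quot.sound h)⟩
  invFun κ := Quot.lift κ.1 κ.2
  left_inv κ := by
    funext c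
    induction c using Quot.ind
    rfl
  right_inv _ := rfl

theorem Equivalent.matrix_eq {m m' : Movie a b} (h : m.Equivalent m') :
    m.matrix = m'.matrix := by
  classical
  obtain ⟨φ, hfirst, hlast, hchi, hdots⟩ := h
  ext σ τ
  rw [matrix_apply, matrix_apply]
  refine Fintype.sum_equiv
    ((m.coloringEquiv.symm.trans (φ.arrowCongr (Equiv.refl Bool))).trans m'.coloringEquiv)
    _ _ (m.coloringEquiv.surjective.forall.2 fun κ => ?_)
  rw [Equiv.trans_apply, Equiv.trans_apply, Equiv.symm_apply_apply]
  set κ' := φ.arrowCongr (Equiv.refl Bool) κ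
  have color (c : m.Component) : κ' (φ c) = κ c := congrArg κ (φ.symm_apply_apply c)
  have first_eq : (m'.coloringEquiv κ').first = (m.coloringEquiv κ).first :=
    Subtype.ext <| funext fun p => (congrArg κ' (hfirst p).symm).trans (color _)
  have last_eq : (m'.coloringEquiv κ').last = (m.coloringEquiv κ).last :=
    Subtype.ext <| funext fun p => (congrArg κ' (hlast p).symm).trans (color _)
  have weight_eq : m.colorWeight (κ ∘ m.component) = m'.colorWeight (κ' ∘ m'.component) := by
    rw [colorWeight_comp, colorWeight_comp]
    refine Fintype.prod_equiv φ _ _ fun c => ?_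
    rw [color]
    exact congrArg₂ (weight · · (κ c)) (hchi c) (hdots c)
  rw [first_eq, last_eq]
  exact if_congr Iff.rfl weight_eq rfl

end Movie

/-! ### Gluing -/

theorem Layer.Joins.shift {L : Layer} {l : ℕ} {p q : ℕ × ℕ} (k : ℕ) (h : L.Joins l p q) :
    L.Joins (k + l) (k + p.1, p.2) (k + q.1, q.2) := by
  cases h <;> constructor <;> assumption

theorem Layer.Joins.le {L : Layer} {l : ℕ} {p q : ℕ × ℕ} (h : L.Joins l p q) :
    (l ≤ p.1 ∧ p.1 ≤ l + 1) ∧ l ≤ q.1 ∧ q.1 ≤ l + 1 := by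
  cases h <;> simp

theorem Layer.Joins.unshift {L : Layer} {l k : ℕ} {p q : ℕ × ℕ} (h : L.Joins (k + l) p q) :
    L.Joins l (p.1 - k, p.2) (q.1 - k, q.2) := by
  generalize hm : k + l = m at h
  have h₁ : m - k = l := by omega
  have h₂ : m + 1 - k = l + 1 := by omega
  cases h <;> simp only [h₁, h₂] <;> constructor <;> assumption

namespace Diagram

theorem width_word (a : Diagram n) : width n a.word = n := a.isTangle.width_eq

/-- The end points on the top side. -/
def firstPt (a : Diagram n) (j : Fin n) : a.Pt := ⟨(0, j), Nat.zero_le _, by simp [width]⟩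

/-- The end points at the bottom. -/
def lastPt (a : Diagram n) (j : Fin n) : a.Pt :=
  ⟨(a.word.length, j), le_rfl, by simp [width_word]⟩

variable {a b : Diagram n}

theorem width_tensor_add (a b : Diagram n) (l : ℕ) :
    width n ((a.tensor b).word.take (a.word.length + l)) = width n (b.word.take l) := by
  simp [tensor, List.take_append, width_append, List.take_of_length_le, width_word]

theorem width_tensor (a b : Diagram n) {l : ℕ} (h : l ≤ a.word.length) :
    width n ((a.tensor b).word.take l) = width n (a.word.take l) := by
  simp [tensor, List.take_append_of_le_length h]

theorem length_tensor (a b : Diagram n) :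
    (a.tensor b).word.length = a.word.length + b.word.length := by
  simp [tensor]

/-- The points of the upper factor. -/
def topPt (b : Diagram n) (p : a.Pt) : (a.tensor b).Pt :=
  ⟨p.1, by rw [length_tensor]; exact p.2.1.trans (Nat.le_add_right _ _), by
    rw [width_tensor a b p.2.1]; exact p.2.2⟩

/-- The points of the lower factor. -/
def botPt (a : Diagram n) (p : b.Pt) : (a.tensor b).Pt :=
  ⟨(a.word.length + p.1.1, p.1.2), by rw [length_tensor]; exact Nat.add_le_add_left p.2.1 _, by
    rw [width_tensor_add a b]; exact p.2.2⟩

theorem topPt_lastPt (j : Fin n) : topPt b (a.lastPt j) = botPt a (b.firstPt j) := rfl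

theorem exists_topPt (P : (a.tensor b).Pt) (h : P.1.1 ≤ a.word.length) :
    ∃ p : a.Pt, P = topPt b p :=
  ⟨⟨P.1, h, width_tensor a b h ▸ P.2.2⟩, rfl⟩

theorem exists_botPt (P : (a.tensor b).Pt) (h : a.word.length ≤ P.1.1) :
    ∃ p : b.Pt, P = botPt a p := by
  obtain ⟨⟨l, j⟩, h₁, h₂⟩ := P
  obtain ⟨k, rfl⟩ := Nat.exists_eq_add_of_le h
  refine ⟨⟨(k, j), ?_, ?_⟩, rfl⟩
  · rw [length_tensor] at h₁
    exact Nat.le_of_add_le_add_left h₁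
  · have := width_tensor_add a b k
    simp only at h₂ this ⊢
    rwa [this] at h₂

theorem topPt_or_botPt (P : (a.tensor b).Pt) :
    (∃ p : a.Pt, P = topPt b p) ∨ ∃ p : b.Pt, P = botPt a p := by
  rcases le_total P.1.1 a.word.length with h | h
  · exact .inl (exists_topPt P h)
  · exact .inr (exists_botPt P h)

theorem joined_topPt {p q : a.Pt} (h : a.Joined p q) :
    (a.tensor b).Joined (topPt b p) (topPt b q) := by
  obtain ⟨l, L, hL, h⟩ := h
  refine ⟨l, L, ?_, h⟩
  rw [tensor, List.getElem?_append_left (List.getElem?_eq_some_iff.1 hL).1, hL]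

theorem joined_botPt {p q : b.Pt} (h : b.Joined p q) :
    (a.tensor b).Joined (botPt a p) (botPt a q) := by
  obtain ⟨l, L, hL, h⟩ := h
  refine ⟨a.word.length + l, L, ?_, h.shift _⟩
  rw [tensor, List.getElem?_append_right (Nat.le_add_right _ _), Nat.add_sub_cancel_left, hL]

theorem joined_tensor {P Q : (a.tensor b).Pt} (h : (a.tensor b).Joined P Q) :
    (∃ p q : a.Pt, P = topPt b p ∧ Q = topPt b q ∧ a.Joined p q) ∨
      ∃ p q : b.Pt, P = botPt a p ∧ Q = botPt a q ∧ b.Joined p q := by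
  obtain ⟨l, L, hL, h⟩ := h
  obtain ⟨⟨h₁, h₂⟩, h₃, h₄⟩ := h.le
  rcases Nat.lt_or_ge l a.word.length with hl | hl
  · obtain ⟨p, rfl⟩ := exists_topPt P (by omega)
    obtain ⟨q, rfl⟩ := exists_topPt Q (by omega)
    rw [tensor, List.getElem?_append_left hl] at hL
    exact .inl ⟨p, q, rfl, rfl, l, L, hL, h⟩
  · obtain ⟨p, rfl⟩ := exists_botPt P (by omega)
    obtain ⟨q, rfl⟩ := exists_botPt Q (by omega)
    obtain ⟨k, rfl⟩ := Nat.exists_eq_add_of_le hl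
    rw [tensor, List.getElem?_append_right hl, Nat.add_sub_cancel_left] at hL
    exact .inr ⟨p, q, rfl, rfl, k, L, hL, by simpa [botPt] using h.unshift⟩

theorem topPt_injective : Function.Injective (topPt b : a.Pt → (a.tensor b).Pt) :=
  fun p q h => Subtype.ext (show p.1 = q.1 from (Subtype.ext_iff.1 h :))

theorem botPt_injective : Function.Injective (botPt a : b.Pt → (a.tensor b).Pt) := by
  intro p q h
  have h := Prod.ext_iff.1 (congrArg Subtype.val h)
  exact Subtype.ext (Prod.ext (Nat.add_left_cancel h.1) h.2)

theorem topPt_eq_botPt {p : a.Pt} {q : b.Pt} (h : topPt b p = botPt a q) :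
    ∃ j, p = a.lastPt j ∧ q = b.firstPt j := by
  obtain ⟨h₁, h₂⟩ := Prod.ext_iff.1 (congrArg Subtype.val h)
  simp only [topPt, botPt] at h₁ h₂
  have hq : q.1.1 = 0 := by have := p.2.1; omega
  have hj : q.1.2 < n := by simpa [hq, width] using q.2.2
  exact ⟨⟨q.1.2, hj⟩, Subtype.ext (Prod.ext (by rw [h₁, hq]; rfl) h₂),
    Subtype.ext (Prod.ext hq rfl)⟩

namespace Coloring

/-- The restriction of a colouring to the upper factor. -/
def top (σ : (a.tensor b).Coloring) : a.Coloring :=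
  ⟨fun p => σ.1 (topPt b p), fun _ _ h => σ.2 _ _ (joined_topPt h)⟩

/-- The restriction of a colouring to the lower factor. -/
def bot (σ : (a.tensor b).Coloring) : b.Coloring :=
  ⟨fun p => σ.1 (botPt a p), fun _ _ h => σ.2 _ _ (joined_botPt h)⟩

theorem top_bot_injective :
    Function.Injective fun σ : (a.tensor b).Coloring => (σ.top, σ.bot) := by
  intro σ τ h
  obtain ⟨h₁, h₂⟩ := Prod.ext_iff.1 h
  ext P
  rcases topPt_or_botPt P with ⟨p, rfl⟩ | ⟨p, rfl⟩
  · exact congrFun (congrArg Subtype.val h₁) p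
  · exact congrFun (congrArg Subtype.val h₂) p

theorem exists_glue (α : a.Coloring) (β : b.Coloring)
    (h : ∀ j, α.1 (a.lastPt j) = β.1 (b.firstPt j)) :
    ∃ σ : (a.tensor b).Coloring, σ.top = α ∧ σ.bot = β := by
  let f : (a.tensor b).Pt → Bool :=
    Function.extend (topPt b) α.1 (Function.extend (botPt a) β.1 fun _ => false)
  have f_top (p) : f (topPt b p) = α.1 p := topPt_injective.extend_apply _ _ p
  have f_bot (q) : f (botPt a q) = β.1 q := by
    by_cases hq : ∃ p, topPt b p = botPt a q
    · obtain ⟨p, hp⟩ := hq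
      obtain ⟨j, rfl, rfl⟩ := topPt_eq_botPt hp
      rw [← hp, f_top, h]
    · exact (Function.extend_apply' _ _ _ hq).trans (botPt_injective.extend_apply _ _ q)
  refine ⟨⟨f, fun P Q hPQ => ?_⟩, Subtype.ext (funext f_top), Subtype.ext (funext f_bot)⟩
  rcases joined_tensor hPQ with ⟨p, q, rfl, rfl, h⟩ | ⟨p, q, rfl, rfl, h⟩
  · rw [f_top, f_top, α.2 p q h]
  · rw [f_bot, f_bot, β.2 p q h]

end Coloring

end Diagram

open Diagram

theorem Event.site_inl_le {x y : List Layer} {E : Event x y} {z : ℕ × ℕ} (h : E.site = .inl z) :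
    z.1 ≤ x.length := by
  cases E <;> cases h <;> simp

theorem Event.site_inr_le {x y : List Layer} {E : Event x y} {z : ℕ × ℕ} (h : E.site = .inr z) :
    z.1 ≤ y.length := by
  cases E <;> cases h <;> simp

namespace Step

variable {a b : Diagram n} (s : Step a b)

theorem length_src : a.word.length = s.u.length + s.x.length + s.v.length := by
  rw [s.src]; simp only [List.length_append]

theorem length_tgt : b.word.length = s.u.length + s.y.length + s.v.length := by
  rw [s.tgt]; simp only [List.length_append]

theorem matches_firstPt (j : Fin n) : s.Matches (a.firstPt j) (b.firstPt j) :=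
  ⟨rfl, .inl ⟨rfl, Nat.zero_le _⟩⟩

theorem matches_lastPt (j : Fin n) : s.Matches (a.lastPt j) (b.lastPt j) :=
  ⟨rfl, .inr ⟨s.v.length, s.length_src, s.length_tgt⟩⟩

theorem eq_of_matrix_ne_zero {σ : a.Coloring} {τ : b.Coloring} (h : s.matrix σ τ ≠ 0) (p : a.Pt)
    (q : b.Pt) (hpq : s.Matches p q) : σ.1 p = τ.1 q :=
  of_not_not fun h' => h (if_neg fun h'' => h' (h'' p q hpq))

theorem glueTop_matches (d : Diagram n) (P : (d.tensor a).Pt) (Q : (d.tensor b).Pt) :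
    (s.glueTop d rfl rfl : Step (d.tensor a) (d.tensor b)).Matches P Q ↔
      (∃ p q, P = botPt d p ∧ Q = botPt d q ∧ s.Matches p q) ∨
        ∃ p, P = topPt a p ∧ Q = topPt b p := by
  have hu : (d.word ++ s.u).length = d.word.length + s.u.length := List.length_append
  constructor
  · rintro ⟨hj, h⟩
    simp only [glueTop, hu] at h
    by_cases hP : P.1.1 = Q.1.1 ∧ P.1.1 ≤ d.word.length
    · obtain ⟨p, rfl⟩ := exists_topPt P hP.2
      exact .inr ⟨p, rfl, Subtype.ext (Prod.ext hP.1.symm hj.symm)⟩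
    · have hle : d.word.length ≤ P.1.1 ∧ d.word.length ≤ Q.1.1 := by
        rcases h with h | ⟨r, h⟩ <;> omega
      obtain ⟨p, rfl⟩ := exists_botPt P hle.1
      obtain ⟨q, rfl⟩ := exists_botPt Q hle.2
      refine .inl ⟨p, q, rfl, rfl, hj, h.imp (fun h => ?_) fun ⟨r, h⟩ => ⟨r, ?_⟩⟩ <;>
        simp only [botPt] at h <;> omega
  · rintro (⟨p, q, rfl, rfl, hj, h⟩ | ⟨p, rfl, rfl⟩)
    · refine ⟨hj, h.imp (fun h => ?_) fun ⟨r, h⟩ => ⟨r, ?_⟩⟩ <;>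
        simp only [glueTop, hu, botPt] <;> omega
    · exact ⟨rfl, .inl ⟨rfl, p.2.1.trans (hu ▸ Nat.le_add_right _ _)⟩⟩

theorem glueBot_matches (d : Diagram n) (P : (a.tensor d).Pt) (Q : (b.tensor d).Pt) :
    (s.glueBot d rfl rfl : Step (a.tensor d) (b.tensor d)).Matches P Q ↔
      (∃ p q, P = topPt d p ∧ Q = topPt d q ∧ s.Matches p q) ∨
        ∃ p, P = botPt a p ∧ Q = botPt b p := by
  have ha := s.length_src
  have hb := s.length_tgt
  constructor
  · rintro ⟨hj, h⟩
    simp only [glueBot] at h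
    by_cases hP : P.1.1 ≤ a.word.length
    · obtain ⟨p, rfl⟩ := exists_topPt P hP
      obtain ⟨q, rfl⟩ := exists_topPt Q (by rcases h with h | ⟨r, h⟩ <;> omega)
      exact .inl ⟨p, q, rfl, rfl, hj, h⟩
    · obtain ⟨p, rfl⟩ := exists_botPt P (le_of_not_ge hP)
      obtain ⟨q, rfl⟩ := exists_botPt Q (by rcases h with h | ⟨r, h⟩ <;> omega)
      refine .inr ⟨p, rfl, congrArg _ (Subtype.ext (Prod.ext ?_ hj.symm))⟩
      simp only [botPt] at h hP
      rcases h with h | ⟨r, h⟩ <;> omega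
  · rintro (⟨p, q, rfl, rfl, h⟩ | ⟨p, rfl, rfl⟩)
    · exact h
    · refine ⟨rfl, .inr ⟨s.v.length + p.1.1, ?_⟩⟩
      simp only [botPt, glueBot]
      omega

theorem glueTop_meets (d : Diagram n) (A : (d.tensor a).Pt → Prop) (B : (d.tensor b).Pt → Prop) :
    (s.glueTop d rfl rfl : Step (d.tensor a) (d.tensor b)).Meets A B ↔
      s.Meets (fun p => A (botPt d p)) fun q => B (botPt d q) := by
  have point {c : Diagram n} (l j : ℕ) (C : (d.tensor c).Pt → Prop) :
      (∃ P, P.1 = (d.word.length + l, j) ∧ C P) ↔ ∃ p : c.Pt, p.1 = (l, j) ∧ C (botPt d p) := by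
    constructor
    · rintro ⟨P, hP, h⟩
      obtain ⟨p, rfl⟩ := exists_botPt P (by simp [hP])
      exact ⟨p, by simpa [botPt, Prod.ext_iff] using hP, h⟩
    · rintro ⟨p, hp, h⟩
      exact ⟨_, by simp [botPt, hp], h⟩
  unfold Meets
  simp only [glueTop, List.length_append, Nat.add_assoc]
  rcases s.event.site with z | z <;> exact point _ _ _

theorem glueBot_meets (d : Diagram n) (A : (a.tensor d).Pt → Prop) (B : (b.tensor d).Pt → Prop) :
    (s.glueBot d rfl rfl : Step (a.tensor d) (b.tensor d)).Meets A B ↔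
      s.Meets (fun p => A (topPt d p)) fun q => B (topPt d q) := by
  have point {c : Diagram n} {z : ℕ × ℕ} (hz : z.1 ≤ c.word.length) (C : (c.tensor d).Pt → Prop) :
      (∃ P, P.1 = z ∧ C P) ↔ ∃ p : c.Pt, p.1 = z ∧ C (topPt d p) := by
    constructor
    · rintro ⟨P, rfl, h⟩
      obtain ⟨p, rfl⟩ := exists_topPt P hz
      exact ⟨p, rfl, h⟩
    · exact fun ⟨p, hp, h⟩ => ⟨_, hp, h⟩
  have ha := s.length_src
  have hb := s.length_tgt
  unfold Meets
  simp only [glueBot]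
  rcases hz : s.event.site with z | z
  · have := Event.site_inl_le hz
    exact point (by simp only; omega) A
  · have := Event.site_inr_le hz
    exact point (by simp only; omega) B

/-- The matrix of a step `s'` that performs `s` on the parts of the diagrams that are embedded by
`i` and `j` and is a product on the rest, which is embedded by `k` and `l`. -/
theorem matrix_of_product {a' b' d : Diagram n} {s : Step a b} {s' : Step a' b'}
    {i : a.Pt → a'.Pt} {j : b.Pt → b'.Pt} {k : d.Pt → a'.Pt} {l : d.Pt → b'.Pt}
    (hchi : s'.event.chi = s.event.chi) (hdots : s'.event.dots = s.event.dots)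
    (hmatches : ∀ P Q, s'.Matches P Q ↔
      (∃ p q, P = i p ∧ Q = j q ∧ s.Matches p q) ∨ ∃ p, P = k p ∧ Q = l p)
    (hmeets : ∀ A B, s'.Meets A B ↔ s.Meets (fun p => A (i p)) fun q => B (j q))
    {σ' : a'.Coloring} {τ' : b'.Coloring} {σ : a.Coloring} {τ : b.Coloring} {ρ ρ' : d.Coloring}
    (hσ : σ.1 = σ'.1 ∘ i) (hτ : τ.1 = τ'.1 ∘ j) (hρ : ρ.1 = σ'.1 ∘ k) (hρ' : ρ'.1 = τ'.1 ∘ l) :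
    s'.matrix σ' τ' = if ρ = ρ' then s.matrix σ τ else 0 := by
  have weight_eq : s'.colorWeight σ'.1 τ'.1 = s.colorWeight σ.1 τ.1 := by
    unfold colorWeight
    rw [hchi, hdots, hσ, hτ]
    classical exact Fintype.prod_congr _ _ fun c => if_congr (hmeets _ _) rfl rfl
  have compatible_iff : (∀ P Q, s'.Matches P Q → σ'.1 P = τ'.1 Q) ↔
      ρ = ρ' ∧ ∀ p q, s.Matches p q → σ.1 p = τ.1 q := by
    have ρ_eq_iff : ρ = ρ' ↔ ∀ p, ρ.1 p = ρ'.1 p := Subtype.ext_iff.trans funext_iff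
    simp only [hmatches, ρ_eq_iff, hσ, hτ, hρ, hρ', Function.comp_apply]
    constructor
    · exact fun h => ⟨fun p => h _ _ (.inr ⟨p, rfl, rfl⟩),
        fun p q hpq => h _ _ (.inl ⟨p, q, rfl, rfl, hpq⟩)⟩
    · rintro ⟨h, h'⟩ P Q (⟨p, q, rfl, rfl, hpq⟩ | ⟨p, rfl, rfl⟩)
      · exact h' p q hpq
      · exact h p
  unfold matrix
  rw [weight_eq, ← ite_and]
  classical exact if_congr compatible_iff rfl rfl

theorem glueTop_matrix (d : Diagram n) (σ : (d.tensor a).Coloring) (τ : (d.tensor b).Coloring) :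
    (s.glueTop d rfl rfl : Step (d.tensor a) (d.tensor b)).matrix σ τ =
      if σ.top = τ.top then s.matrix σ.bot τ.bot else 0 :=
  matrix_of_product (i := botPt d) (j := botPt d) (k := topPt a) (l := topPt b) rfl rfl
    (s.glueTop_matches d) (s.glueTop_meets d) rfl rfl rfl rfl

theorem glueBot_matrix (d : Diagram n) (σ : (a.tensor d).Coloring) (τ : (b.tensor d).Coloring) :
    (s.glueBot d rfl rfl : Step (a.tensor d) (b.tensor d)).matrix σ τ =
      if σ.bot = τ.bot then s.matrix σ.top τ.top else 0 :=
  matrix_of_product (i := topPt d) (j := topPt d) (k := botPt a) (l := botPt b) rfl rfl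
    (s.glueBot_matches d) (s.glueBot_meets d) rfl rfl rfl rfl

end Step

theorem sum_mul_sum_of_injective {E A B K : Type} [Fintype E] [Finite A] [Fintype B]
    [DecidableEq A] [CommSemiring K] {π : E → A × B} (hπ : Function.Injective π) (x y : A)
    (F G : B → K) (hF : ∀ β, F β ≠ 0 → (x, β) ∈ Set.range π) :
    ∑ ρ, (if x = (π ρ).1 then F (π ρ).2 else 0) * (if (π ρ).1 = y then G (π ρ).2 else 0) =
      if x = y then ∑ β, F β * G β else 0 := by
  have := Fintype.ofFinite A
  let f (p : A × B) : K := (if x = p.1 then F p.2 else 0) * (if p.1 = y then G p.2 else 0)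
  have f_eq_zero (p) (hp : p ∉ Set.range π) : f p = 0 := by
    obtain ⟨x', β⟩ := p
    by_cases hx : x = x'
    · have : F β = 0 := of_not_not fun h => hp (hx ▸ hF β h)
      simp [f, this]
    · simp [f, hx]
  rw [Fintype.sum_of_injective π hπ _ f f_eq_zero fun _ => rfl, Fintype.sum_prod_type]
  simp [f]

namespace Movie

variable {a b : Diagram n}

theorem eq_of_matrix_ne_zero (m : Movie a b) {σ : a.Coloring} {τ : b.Coloring}
    (h : m.matrix σ τ ≠ 0) (j : Fin n) :
    σ.1 (a.firstPt j) = τ.1 (b.firstPt j) ∧ σ.1 (a.lastPt j) = τ.1 (b.lastPt j) := by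
  induction m with
  | nil =>
    obtain rfl : σ = τ := of_not_not fun hs => h (Matrix.one_apply_ne hs)
    exact ⟨rfl, rfl⟩
  | snoc m s ih =>
    rw [matrix, Matrix.mul_apply] at h
    obtain ⟨ρ, -, hρ⟩ := Finset.exists_ne_zero_of_sum_ne_zero h
    have hm := ih (left_ne_zero_of_mul hρ)
    have hs := s.eq_of_matrix_ne_zero (right_ne_zero_of_mul hρ)
    exact ⟨hm.1.trans (hs _ _ (s.matches_firstPt j)), hm.2.trans (hs _ _ (s.matches_lastPt j))⟩

theorem glueTop_matrix (d : Diagram n) (m : Movie a b) (σ : (d.tensor a).Coloring)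
    (τ : (d.tensor b).Coloring) :
    (m.glueTop d).matrix σ τ = if σ.top = τ.top then m.matrix σ.bot τ.bot else 0 := by
  induction m with
  | nil =>
    simp only [glueTop, matrix, Matrix.one_apply, ← ite_and]
    exact if_congr (Coloring.top_bot_injective.eq_iff.symm.trans Prod.ext_iff) rfl rfl
  | snoc m s ih =>
    simp only [glueTop, matrix, Matrix.mul_apply, ih, Step.glueTop_matrix]
    refine sum_mul_sum_of_injective Coloring.top_bot_injective _ _
      (fun ρ => m.matrix σ.bot ρ) (fun ρ => s.matrix ρ τ.bot) fun ρ hρ => ?_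
    obtain ⟨κ, h₁, h₂⟩ := Coloring.exists_glue σ.top ρ fun j =>
      (congrArg σ.1 (topPt_lastPt j)).trans (m.eq_of_matrix_ne_zero hρ j).1
    exact ⟨κ, Prod.ext h₁ h₂⟩

theorem glueBot_matrix (d : Diagram n) (m : Movie a b) (σ : (a.tensor d).Coloring)
    (τ : (b.tensor d).Coloring) :
    (m.glueBot d).matrix σ τ = if σ.bot = τ.bot then m.matrix σ.top τ.top else 0 := by
  induction m with
  | nil =>
    simp only [glueBot, matrix, Matrix.one_apply, ← ite_and]
    refine if_congr ?_ rfl rfl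
    rw [and_comm]
    exact Coloring.top_bot_injective.eq_iff.symm.trans Prod.ext_iff
  | snoc m s ih =>
    simp only [glueBot, matrix, Matrix.mul_apply, ih, Step.glueBot_matrix]
    refine sum_mul_sum_of_injective
      (Prod.swap_injective.comp Coloring.top_bot_injective) _ _
      (fun ρ => m.matrix σ.top ρ) (fun ρ => s.matrix ρ τ.top) fun ρ hρ => ?_
    obtain ⟨κ, h₁, h₂⟩ := Coloring.exists_glue ρ σ.bot fun j =>
      (m.eq_of_matrix_ne_zero hρ j).2.symm.trans (congrArg σ.1 (topPt_lastPt j))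
    exact ⟨κ, Prod.ext h₂ h₁⟩

end Movie

/-! ### The sphere and neck cutting relations in the state sum -/

namespace Diagram

/-- The pair `z` is a point of the diagram. -/
def IsPt (a : Diagram n) (z : ℕ × ℕ) : Prop :=
  z.1 ≤ a.word.length ∧ z.2 < width n (a.word.take z.1)

end Diagram

theorem IsTangle.le_width {m k i : ℕ} {u v : List Layer} (h : IsTangle m k (u ++ .cap i :: v)) :
    i ≤ width m u := by
  induction u generalizing m with
  | nil => exact h.1
  | cons L u ih => cases L <;> exact ih h.2

namespace CircleSite

variable (s : CircleSite n)

theorem length_out : s.out.word.length = s.u.length + s.v.length := List.length_append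

theorem length_circ : s.circ.word.length = s.u.length + s.v.length + 2 := by
  simp only [circ, List.length_append, List.length_cons, List.length_nil]
  omega

theorem circ_word : s.circ.word = s.u ++ .cap s.i :: .cup s.i :: s.v := by simp [circ]

theorem i_le : s.i ≤ width n s.u := (s.circ_word ▸ s.circ.isTangle).le_width

theorem isPt_circ_of_le {z : ℕ × ℕ} (h : z.1 ≤ s.u.length) :
    s.circ.IsPt z ↔ s.out.IsPt z := by
  have hw : s.circ.word.take z.1 = s.out.word.take z.1 := by
    rw [circ_word, out, List.take_append_of_le_length h, List.take_append_of_le_length h]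
  simp only [Diagram.IsPt, hw, length_circ, length_out]
  omega

theorem isPt_out_mid {j : ℕ} : s.out.IsPt (s.u.length, j) ↔ j < width n s.u := by
  simp [Diagram.IsPt, out]

theorem isPt_circ_mid {j : ℕ} : s.circ.IsPt (s.u.length + 1, j) ↔ j < width n s.u + 2 := by
  simp [Diagram.IsPt, circ_word, List.take_append, List.take_of_length_le, width_append, width]

theorem isPt_circ_add {l j : ℕ} (h : s.u.length ≤ l) :
    s.circ.IsPt (l + 2, j) ↔ s.out.IsPt (l, j) := by
  obtain ⟨k, rfl⟩ := Nat.exists_eq_add_of_le h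
  have hw : width n (s.circ.word.take (s.u.length + k + 2)) =
      width n (s.out.word.take (s.u.length + k)) := by
    simp [circ_word, out, List.take_append, List.take_of_length_le, width_append, width,
      Nat.add_assoc]
  simp only [Diagram.IsPt, hw, length_circ, length_out]
  omega

theorem getElem_circ {l : ℕ} (h : l < s.u.length) : s.circ.word[l]? = s.out.word[l]? := by
  rw [circ_word, out, List.getElem?_append_left h, List.getElem?_append_left h]

theorem getElem_circ_add {l : ℕ} (h : s.u.length ≤ l) : s.circ.word[l + 2]? = s.out.word[l]? := by
  obtain ⟨k, rfl⟩ := Nat.exists_eq_add_of_le h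
  simp [circ_word, out, List.getElem?_append, Nat.add_assoc]

theorem getElem_cap : s.circ.word[s.u.length]? = some (.cap s.i) := by
  simp [circ_word]

theorem getElem_cup : s.circ.word[s.u.length + 1]? = some (.cup s.i) := by
  simp [circ_word]

/-- Shrinks the two layers of the circle to the line that they replace; the result is `none` on the
circle itself. -/
def collapse (z : ℕ × ℕ) : Option (ℕ × ℕ) :=
  if z.1 ≤ s.u.length then some z
  else if z.1 = s.u.length + 1 then
    if z.2 < s.i then some (s.u.length, z.2)
    else if z.2 < s.i + 2 then none
    else some (s.u.length, z.2 - 2)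
  else some (z.1 - 2, z.2)

theorem collapse_of_le {z : ℕ × ℕ} (h : z.1 ≤ s.u.length) : s.collapse z = some z := if_pos h

theorem collapse_add {l j : ℕ} (h : s.u.length ≤ l) : s.collapse (l + 2, j) = some (l, j) := by
  simp only [collapse]
  rw [if_neg (by omega), if_neg (by omega), Nat.add_sub_cancel]

theorem collapse_eq_none_iff {z : ℕ × ℕ} : s.collapse z = none ↔
    z = (s.u.length + 1, s.i) ∨ z = (s.u.length + 1, s.i + 1) := by
  simp only [collapse, Prod.ext_iff]
  grind

theorem collapse_eq_some_iff {z w : ℕ × ℕ} : s.collapse z = some w ↔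
    (w.1 ≤ s.u.length ∧ z = w) ∨ (s.u.length ≤ w.1 ∧ z = (w.1 + 2, w.2)) ∨
      w.1 = s.u.length ∧ z = (s.u.length + 1, if w.2 < s.i then w.2 else w.2 + 2) := by
  simp only [collapse, Prod.ext_iff]
  split_ifs <;> simp only [Option.some.injEq, Prod.ext_iff, false_iff] <;> omega

theorem isPt_of_collapse_eq_some {z w : ℕ × ℕ} (hz : s.circ.IsPt z) (h : s.collapse z = some w) :
    s.out.IsPt w := by
  obtain ⟨l, j⟩ := w
  rcases s.collapse_eq_some_iff.1 h with ⟨hl, rfl⟩ | ⟨hl, rfl⟩ | ⟨rfl, rfl⟩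
  · exact (s.isPt_circ_of_le hl).1 hz
  · exact (s.isPt_circ_add hl).1 hz
  · have := s.i_le
    rw [isPt_circ_mid] at hz
    rw [isPt_out_mid]
    grind

theorem collapse_joins {l : ℕ} {L : Layer} {z z' : ℕ × ℕ} (hL : s.circ.word[l]? = some L)
    (h : L.Joins l z z') : s.collapse z = s.collapse z' ∨ ∃ w w' l', s.collapse z = some w ∧
      s.collapse z' = some w' ∧ s.out.word[l']? = some L ∧ L.Joins l' w w' := by
  obtain ⟨⟨h₁, h₂⟩, h₃, h₄⟩ := h.le
  rcases Nat.lt_trichotomy l s.u.length with hl | rfl | hl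
  · exact .inr ⟨z, z', l, s.collapse_of_le (by omega), s.collapse_of_le (by omega),
      s.getElem_circ hl ▸ hL, h⟩
  · left
    rw [getElem_cap, Option.some.injEq] at hL
    subst hL
    cases h <;> simp only [collapse] <;> grind
  rcases (Nat.succ_le_of_lt hl).eq_or_lt with rfl | hl
  · left
    rw [Nat.succ_eq_add_one, getElem_cup, Option.some.injEq] at hL
    subst hL
    cases h <;> simp only [collapse] <;> grind
  · obtain ⟨k, rfl⟩ : ∃ k, l = k + 2 := ⟨l - 2, by omega⟩
    obtain ⟨⟨l₁, j₁⟩, l₂, j₂⟩ := z, z'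
    obtain ⟨k₁, rfl⟩ : ∃ k, l₁ = k + 2 := ⟨l₁ - 2, by simp only at h₁; omega⟩
    obtain ⟨k₂, rfl⟩ : ∃ k, l₂ = k + 2 := ⟨l₂ - 2, by simp only at h₃; omega⟩
    simp only at h₁ h₃
    have hk : s.u.length ≤ k := by omega
    refine .inr ⟨_, _, k, s.collapse_add (by omega), s.collapse_add (by omega),
      s.getElem_circ_add hk ▸ hL, ?_⟩
    rw [add_comm k 2] at h
    exact h.unshift

/-- A point of the circle. -/
def circlePt : s.circ.Pt := ⟨(s.u.length + 1, s.i), s.isPt_circ_mid.2 (by have := s.i_le; omega)⟩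

/-- The point of the complement of the circle to which a point collapses. -/
def down (P : s.circ.Pt) : Option s.out.Pt :=
  (s.collapse P.1).pmap Subtype.mk fun _ => s.isPt_of_collapse_eq_some P.2

/-- A point of the diagram, after the insertion of the circle. -/
def embPt (p : s.out.Pt) : s.circ.Pt :=
  if h : p.1.1 ≤ s.u.length then ⟨p.1, (s.isPt_circ_of_le h).2 p.2⟩
  else ⟨(p.1.1 + 2, p.1.2), (s.isPt_circ_add (le_of_not_ge h)).2 p.2⟩

variable {s}

theorem down_eq_none_iff {P : s.circ.Pt} : s.down P = none ↔ s.collapse P.1 = none :=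
  Option.pmap_eq_none_iff

theorem down_eq_some_iff {P : s.circ.Pt} {p : s.out.Pt} :
    s.down P = some p ↔ s.collapse P.1 = some p.1 :=
  Option.pmap_eq_some_iff.trans
    ⟨fun ⟨_, _, h, h'⟩ => h' ▸ h, fun h => ⟨_, p.2, h, rfl⟩⟩

theorem down_circlePt : s.down s.circlePt = none :=
  down_eq_none_iff.2 (s.collapse_eq_none_iff.2 (.inl rfl))

theorem down_embPt (p : s.out.Pt) : s.down (s.embPt p) = some p := by
  unfold embPt
  split_ifs with h
  · exact down_eq_some_iff.2 (s.collapse_of_le h)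
  · exact down_eq_some_iff.2 (s.collapse_add (le_of_not_ge h))

theorem down_joined {P Q : s.circ.Pt} (h : s.circ.Joined P Q) :
    s.down P = s.down Q ∨ ∃ p q, s.down P = some p ∧ s.down Q = some q ∧ s.out.Joined p q := by
  obtain ⟨l, L, hL, h⟩ := h
  rcases s.collapse_joins hL h with h | ⟨w, w', l', hw, hw', hL', h⟩
  · refine .inl (Option.ext fun p => ?_)
    rw [down_eq_some_iff, down_eq_some_iff, h]
  · exact .inr ⟨⟨w, s.isPt_of_collapse_eq_some P.2 hw⟩, ⟨w', s.isPt_of_collapse_eq_some Q.2 hw'⟩,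
      down_eq_some_iff.2 hw, down_eq_some_iff.2 hw', l', L, hL', h⟩

/-- The colour of the circle. -/
def circleColor (τ : s.circ.Coloring) : Bool := τ.1 s.circlePt

theorem color_of_down_eq_none (τ : s.circ.Coloring) {P : s.circ.Pt} (h : s.down P = none) :
    τ.1 P = circleColor τ := by
  obtain ⟨z, hz⟩ := P
  rcases s.collapse_eq_none_iff.1 (down_eq_none_iff.1 h) with rfl | rfl
  · rfl
  · exact (τ.2 s.circlePt _ ⟨_, _, s.getElem_cap, .cap_turn _⟩).symm

theorem color_of_down_eq_some (τ : s.circ.Coloring) {P : s.circ.Pt} {p : s.out.Pt}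
    (h : s.down P = some p) : τ.1 P = τ.1 (s.embPt p) := by
  obtain ⟨z, hz⟩ := P
  obtain ⟨⟨l, j⟩, hp⟩ := p
  have mid (z : ℕ × ℕ) (hz : s.circ.IsPt z) (hl : l = s.u.length)
      (hz' : z = (s.u.length + 1, if j < s.i then j else j + 2)) :
      τ.1 ⟨z, hz⟩ = τ.1 (s.embPt ⟨(l, j), hp⟩) := by
    subst hl hz'
    rw [embPt, dif_pos le_rfl]
    refine (τ.2 _ _ ⟨_, _, s.getElem_cap, ?_⟩).symm
    split_ifs with hj
    · exact .cap_left _ _ hj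
    · exact .cap_right _ _ (not_lt.1 hj)
  rcases s.collapse_eq_some_iff.1 (down_eq_some_iff.1 h) with ⟨hl, rfl⟩ | ⟨hl, rfl⟩ | ⟨hl, h⟩
  · rw [embPt, dif_pos hl]
  · rcases hl.eq_or_lt with hl | hl
    · simp only at hl
      subst hl
      have hj : s.circ.IsPt (s.u.length + 1, if j < s.i then j else j + 2) := by
        have := s.isPt_out_mid.1 hp
        rw [isPt_circ_mid]
        split_ifs <;> omega
      rw [← mid _ hj rfl rfl]
      refine (τ.2 _ _ ⟨_, _, s.getElem_cup, ?_⟩).symm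
      split_ifs with h
      · exact .cup_left _ _ h
      · exact .cup_right _ _ (not_lt.1 h)
    · rw [embPt, dif_neg (not_le.2 hl)]
  · exact mid z hz hl h

/-- The restriction of a colouring to the complement of the circle. -/
def restrict (τ : s.circ.Coloring) : s.out.Coloring := ⟨fun p => τ.1 (s.embPt p), by
  rintro ⟨z, hz⟩ ⟨z', hz'⟩ ⟨l, L, hL, h⟩
  obtain ⟨⟨h₁, h₂⟩, h₃, h₄⟩ := h.le
  simp only at h h₁ h₂ h₃ h₄
  rcases Nat.lt_or_ge l s.u.length with hl | hl
  · rw [← s.getElem_circ hl] at hL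
    change τ.1 (s.embPt _) = τ.1 (s.embPt _)
    rw [embPt, embPt, dif_pos (by simp only; omega), dif_pos (by simp only; omega)]
    exact τ.2 _ _ ⟨l, L, hL, h⟩
  · rw [← s.getElem_circ_add hl] at hL
    have isPt (z : ℕ × ℕ) (hz : s.out.IsPt z) (hl : l ≤ z.1) : s.circ.IsPt (z.1 + 2, z.2) :=
      (s.isPt_circ_add (by omega)).2 hz
    change τ.1 (s.embPt _) = τ.1 (s.embPt _)
    rw [← color_of_down_eq_some τ (P := ⟨_, isPt z hz h₁⟩)
        (down_eq_some_iff.2 (s.collapse_add (by omega))),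
      ← color_of_down_eq_some τ (P := ⟨_, isPt z' hz' h₃⟩)
        (down_eq_some_iff.2 (s.collapse_add (by omega)))]
    refine τ.2 _ _ ⟨l + 2, L, hL, ?_⟩
    simpa only [add_comm 2] using h.shift 2⟩

/-- A colouring is given by the colour of the circle and a colouring of the rest. -/
def coloringEquiv : s.circ.Coloring ≃ s.out.Coloring × Bool where
  toFun τ := (restrict τ, circleColor τ)
  invFun x := ⟨fun P => (s.down P).elim x.2 x.1.1, fun P Q h => by
    rcases down_joined h with h | ⟨p, q, hp, hq, h⟩
    · simp only [h]
    · simpa only [hp, hq, Option.elim_some] using x.1.2 p q h⟩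
  left_inv τ := by
    ext P
    cases h : s.down P with
    | none => simp [h, color_of_down_eq_none τ h]
    | some p => simp [h, color_of_down_eq_some τ h, restrict]
  right_inv x := by
    refine Prod.ext (Subtype.ext (funext fun p => ?_)) ?_
    · simp [restrict, down_embPt]
    · simp [circleColor, down_circlePt]

/-- The two points lie on the same vertical segment outside of the circle. -/
def Corresponds (P : s.circ.Pt) (p : s.out.Pt) : Prop :=
  P.1.2 = p.1.2 ∧ ((P.1.1 = p.1.1 ∧ P.1.1 ≤ s.u.length) ∨
    ∃ r, P.1.1 = s.u.length + 2 + r ∧ p.1.1 = s.u.length + r)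

theorem restrict_eq_iff {τ : s.circ.Coloring} {σ : s.out.Coloring} :
    restrict τ = σ ↔ ∀ P p, Corresponds P p → τ.1 P = σ.1 p := by
  constructor
  · rintro rfl P p ⟨hj, h⟩
    refine color_of_down_eq_some τ (down_eq_some_iff.2 (s.collapse_eq_some_iff.2 ?_))
    rcases h with ⟨h, hl⟩ | ⟨r, h, h'⟩
    · exact .inl ⟨h ▸ hl, Prod.ext h hj⟩
    · exact .inr (.inl ⟨by omega, Prod.ext (by simp only; omega) hj⟩)
  · refine fun h => Subtype.ext (funext fun p => h _ p ?_)
    unfold embPt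
    split_ifs with hp
    · exact ⟨rfl, .inl ⟨rfl, hp⟩⟩
    · exact ⟨rfl, .inr ⟨p.1.1 - s.u.length, by simp only; omega, by omega⟩⟩

end CircleSite

namespace Step

variable {a b : Diagram n} (s : Step a b)

open Classical in
theorem matrix_of_meets_left {p : a.Pt} (σ : a.Coloring) (τ : b.Coloring)
    (h : ∀ A B, s.Meets A B ↔ A p) : s.matrix σ τ = if ∀ p q, s.Matches p q → σ.1 p = τ.1 q then
      weight s.event.chi s.event.dots (σ.1 p) else 0 := by
  simp [matrix, colorWeight, h]

open Classical in
theorem matrix_of_meets_right {q : b.Pt} (σ : a.Coloring) (τ : b.Coloring)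
    (h : ∀ A B, s.Meets A B ↔ B q) : s.matrix σ τ = if ∀ p q, s.Matches p q → σ.1 p = τ.1 q then
      weight s.event.chi s.event.dots (τ.1 q) else 0 := by
  simp [matrix, colorWeight, h]

end Step

theorem exists_eq_and_iff {a : Diagram n} (p : a.Pt) (A : a.Pt → Prop) :
    (∃ p', p'.1 = p.1 ∧ A p') ↔ A p :=
  ⟨fun ⟨_, h, hA⟩ => Subtype.ext h ▸ hA, fun hA => ⟨p, rfl, hA⟩⟩

namespace CircleSite

variable {s : CircleSite n}

theorem birth_matrix (σ : s.out.Coloring) (τ : s.circ.Coloring) :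
    s.birth.matrix σ τ = if restrict τ = σ then diskValue (circleColor τ) else 0 := by
  rw [birth, Movie.matrix_ofStep,
    Step.matrix_of_meets_right (q := s.circlePt) (h := fun _ B => ?_)]
  swap; · exact exists_eq_and_iff s.circlePt B
  classical
  refine if_congr (Iff.trans ?_ restrict_eq_iff.symm)
    (by simp [weight, Event.chi, Event.dots, circleColor]) rfl
  have symm (p : s.out.Pt) (P : s.circ.Pt) : Corresponds P p ↔ p.1.2 = P.1.2 ∧
      ((p.1.1 = P.1.1 ∧ p.1.1 ≤ s.u.length) ∨
        ∃ r, p.1.1 = s.u.length + r ∧ P.1.1 = s.u.length + 2 + r) := by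
    grind [Corresponds]
  exact ⟨fun h P p hP => (h p P ((symm p P).1 hP)).symm,
    fun h p P hP => (h P p ((symm p P).2 hP)).symm⟩

theorem death_matrix (τ : s.circ.Coloring) (σ : s.out.Coloring) :
    s.death.matrix τ σ = if restrict τ = σ then diskValue (circleColor τ) else 0 := by
  rw [death, Movie.matrix_ofStep,
    Step.matrix_of_meets_left (p := s.circlePt) (h := fun A _ => ?_)]
  swap; · exact exists_eq_and_iff s.circlePt A
  classical
  exact if_congr restrict_eq_iff.symm (by simp [weight, Event.chi, Event.dots, circleColor]) rfl

theorem dot_matrix : s.dot.matrix = Matrix.diagonal fun τ => dotValue (circleColor τ) := by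
  ext σ τ
  have hsite (A : s.circ.Pt → Prop) :
      (∃ p, p.1 = ((s.u ++ [Layer.cap s.i]).length + 0, s.i) ∧ A p) ↔ A s.circlePt := by
    simpa [circlePt] using exists_eq_and_iff s.circlePt A
  rw [dot, Movie.matrix_ofStep,
    Matrix.diagonal_apply,
    Step.matrix_of_meets_left (p := s.circlePt) (h := fun A _ => ?_)]
  swap; · exact hsite A
  classical
  refine if_congr ⟨fun h => Subtype.ext (funext fun p => h p p ⟨rfl, ?_⟩), ?_⟩
    (by simp [weight, Event.chi, Event.dots, circleColor]) rfl
  · exact (le_total p.1.1 _).imp (⟨rfl, ·⟩) fun h =>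
      (Nat.exists_eq_add_of_le h).imp fun _ h => ⟨h, h⟩
  · rintro rfl p q ⟨hj, h⟩
    refine congrArg _ (Subtype.ext (Prod.ext ?_ hj))
    exact h.elim And.left fun ⟨r, h, h'⟩ => h.trans h'.symm

theorem birth_mul_death (f : Bool → ZMod 17) :
    s.birth.matrix * ((Matrix.diagonal fun τ => f (circleColor τ) :
        Matrix s.circ.Coloring s.circ.Coloring (ZMod 17)) * s.death.matrix) =
      (∑ c, diskValue c * (f c * diskValue c)) • (1 : Matrix _ _ (ZMod 17)) := by
  ext σ σ'
  calc
    _ = ∑ τ : s.circ.Coloring, (if restrict τ = σ then diskValue (circleColor τ) else 0) *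
          (f (circleColor τ) * if restrict τ = σ' then diskValue (circleColor τ) else 0) := by
      rw [Matrix.mul_apply]
      simp only [Matrix.diagonal_mul, birth_matrix, death_matrix]
    _ = ∑ x : s.out.Coloring × Bool, (if x.1 = σ then diskValue x.2 else 0) *
          (f x.2 * if x.1 = σ' then diskValue x.2 else 0) :=
      Fintype.sum_equiv coloringEquiv _ _ fun _ => rfl
    _ = ((∑ c, diskValue c * (f c * diskValue c)) • (1 : Matrix _ _ (ZMod 17))) σ σ' := by
      rw [Fintype.sum_prod_type_right]
      by_cases h : σ = σ'
      · simp [h]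
      · simp [h, Ne.symm h]

theorem neck_matrix : s.death.matrix * (s.birth.matrix * s.dot.matrix) +
    s.dot.matrix * (s.death.matrix * s.birth.matrix) = 1 := by
  ext τ τ'
  have neck_values (c c' : Bool) : diskValue c * (diskValue c' * dotValue c') +
      dotValue c * (diskValue c * diskValue c') = if c = c' then 1 else 0 := by
    revert c c'; decide
  have eq_iff : τ = τ' ↔ restrict τ = restrict τ' ∧ circleColor τ = circleColor τ' :=
    coloringEquiv.injective.eq_iff.symm.trans Prod.ext_iff
  rw [Matrix.add_apply, dot_matrix, Matrix.diagonal_mul, Matrix.mul_apply, Matrix.mul_apply]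
  simp only [Matrix.mul_diagonal, birth_matrix, death_matrix, ite_mul, mul_ite, zero_mul, mul_zero,
    Finset.sum_ite_eq, Finset.mem_univ, if_true, Matrix.one_apply, eq_iff, ite_and,
    ← neck_values, ite_add_zero]

end CircleSite

/-! ### The state sum on `Cob n` -/

namespace CircleSite

variable {s : CircleSite n}

theorem birth_mul_dot_pow_mul_death (k : ℕ) :
    s.birth.matrix * (s.dot.matrix ^ k * s.death.matrix) =
      (if Odd k then (1 : ZMod 17) else 0) • (1 : Matrix _ _ (ZMod 17)) := by
  rw [dot_matrix, Matrix.diagonal_pow]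
  refine (birth_mul_death fun c => dotValue c ^ k).trans (congrArg (· • _) ?_)
  rw [Fintype.sum_bool]
  rcases Nat.even_or_odd k with h | h
  · simp only [dotValue, diskValue, if_true, Bool.false_eq_true, if_false, one_pow, h.neg_one_pow,
      if_neg (Nat.not_odd_iff_even.2 h)]
    decide
  · simp only [dotValue, diskValue, if_true, Bool.false_eq_true, if_false, one_pow, h.neg_one_pow,
      if_pos h]
    decide

theorem sphere_matrix : (s.birth.comp s.death).matrix = 0 := by
  simpa [Movie.matrix_comp] using s.birth_mul_dot_pow_mul_death 0

theorem sphere_dot_matrix : (s.birth.comp (s.dot.comp s.death)).matrix = 1 := by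
  simpa [Movie.matrix_comp] using s.birth_mul_dot_pow_mul_death 1

theorem sphere_dot_dot_matrix : (s.birth.comp (s.dot.comp (s.dot.comp s.death))).matrix = 0 := by
  simpa [Movie.matrix_comp, pow_succ, Matrix.mul_assoc, show ¬ Odd 2 by decide]
    using s.birth_mul_dot_pow_mul_death 2

theorem sphere_dot_dot_dot_matrix :
    (s.birth.comp (s.dot.comp (s.dot.comp (s.dot.comp s.death)))).matrix = 1 := by
  simpa [Movie.matrix_comp, pow_succ, Matrix.mul_assoc, show Odd 3 by decide]
    using s.birth_mul_dot_pow_mul_death 3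

end CircleSite

/-- The homomorphism `ℤ[α] → 𝔽₁₇` that sends `α` to `1`. -/
def scalar : R →+* ZMod 17 := Polynomial.eval₂RingHom (Int.castRingHom (ZMod 17)) 1

local instance : Algebra R (ZMod 17) := scalar.toAlgebra

theorem alpha_smul {I J : Type} (M : Matrix I J (ZMod 17)) : alpha • M = M := by
  ext i j
  exact (Algebra.smul_def alpha (M i j)).trans
    ((congrArg (· * M i j) (Polynomial.eval₂_X _ _)).trans (one_mul _))

/-- The diagram of an object of `PreCob n`. -/
def preDiagram (X : PreCob n) : Diagram n := GradedDiagram.diagram X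

/-- A movie as a morphism of `PreCob n`; this is `lin` for objects that are not spelled out. -/
def movieHom {X Y : PreCob n} (m : Movie (preDiagram X) (preDiagram Y)) : X ⟶ Y :=
  lin (GradedDiagram.deg X) (GradedDiagram.deg Y) m

theorem movieHom_comp {X Y Z : PreCob n} (m : Movie (preDiagram X) (preDiagram Y))
    (m' : Movie (preDiagram Y) (preDiagram Z)) :
    movieHom m ≫ movieHom m' = movieHom (m.comp m') :=
  ((Free.embedding R (GradedDiagram n)).map_comp _ _).symm

theorem preTop_map_movieHom (D : GradedDiagram n) {X Y : PreCob n}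
    (m : Movie (preDiagram X) (preDiagram Y)) :
    (preTop D).map (movieHom m) =
      movieHom (X := (preTop D).obj X) (Y := (preTop D).obj Y) (m.glueTop D.diagram) :=
  (Finsupp.sum_single_index (a := m) (b := (1 : R))
    (h := fun m r => r • movieHom (X := (preTop D).obj X) (Y := (preTop D).obj Y)
      (m.glueTop D.diagram)) (zero_smul R _)).trans (one_smul R _)

theorem preBot_map_movieHom (D : GradedDiagram n) {X Y : PreCob n}
    (m : Movie (preDiagram X) (preDiagram Y)) :
    (preBot D).map (movieHom m) =
      movieHom (X := (preBot D).obj X) (Y := (preBot D).obj Y) (m.glueBot D.diagram) :=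
  (Finsupp.sum_single_index (a := m) (b := (1 : R))
    (h := fun m r => r • movieHom (X := (preBot D).obj X) (Y := (preBot D).obj Y)
      (m.glueBot D.diagram)) (zero_smul R _)).trans (one_smul R _)

instance (D : GradedDiagram n) : (preTop D).Linear R := inferInstanceAs ((Free.lift R _).Linear R)

instance (D : GradedDiagram n) : (preBot D).Linear R := inferInstanceAs ((Free.lift R _).Linear R)

theorem preCob_induction {X Y : PreCob n} {motive : (X ⟶ Y) → Prop} (f : X ⟶ Y)
    (zero : motive 0) (add : ∀ f g, motive f → motive g → motive (f + g))
    (smul : ∀ (r : R) (m : Movie (preDiagram X) (preDiagram Y)), motive (r • movieHom m)) :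
    motive f :=
  Finsupp.induction_linear (motive := motive) f zero add fun m r =>
    (Finsupp.smul_single_one m r) ▸ smul r m

/-- The state sum of a linear combination of movies. -/
def homMatrix {X Y : PreCob n} :
    (X ⟶ Y) →ₗ[R] Matrix (preDiagram X).Coloring (preDiagram Y).Coloring (ZMod 17) :=
  Finsupp.linearCombination R fun m : Movie (preDiagram X) (preDiagram Y) => m.matrix

theorem homMatrix_movieHom {X Y : PreCob n} (m : Movie (preDiagram X) (preDiagram Y)) :
    homMatrix (movieHom m) = m.matrix :=
  (Finsupp.linearCombination_single R _ _).trans (one_smul _ _)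

theorem homMatrix_comp {X Y Z : PreCob n} (f : X ⟶ Y) (g : Y ⟶ Z) :
    homMatrix (f ≫ g) = homMatrix f * homMatrix g := by
  induction f using preCob_induction with
  | zero => rw [zero_comp, map_zero, map_zero, Matrix.zero_mul]
  | add f f' hf hf' => rw [Preadditive.add_comp, map_add, map_add, Matrix.add_mul, hf, hf']
  | smul r m =>
    induction g using preCob_induction with
    | zero => rw [comp_zero, map_zero, map_zero, Matrix.mul_zero]
    | add g g' hg hg' => rw [Preadditive.comp_add, map_add, map_add, Matrix.mul_add, hg, hg']
    | smul r' m' =>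
      rw [Linear.smul_comp, Linear.comp_smul, movieHom_comp]
      simp only [map_smul, homMatrix_movieHom, Movie.matrix_comp, Matrix.smul_mul, Matrix.mul_smul]
      exact smul_comm r r' _

theorem homMatrix_preTop (D : GradedDiagram n) {X Y : PreCob n} (f : X ⟶ Y)
    (σ : (preDiagram ((preTop D).obj X)).Coloring) (τ : (preDiagram ((preTop D).obj Y)).Coloring) :
    homMatrix ((preTop D).map f) σ τ =
      if Diagram.Coloring.top (a := D.diagram) (b := preDiagram X) σ =
          Diagram.Coloring.top (a := D.diagram) (b := preDiagram Y) τ then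
        homMatrix f (Diagram.Coloring.bot (a := D.diagram) (b := preDiagram X) σ)
          (Diagram.Coloring.bot (a := D.diagram) (b := preDiagram Y) τ)
      else 0 := by
  induction f using preCob_induction with
  | zero => simp only [Functor.map_zero, map_zero, Matrix.zero_apply, ite_self]
  | add f g hf hg =>
    rw [Functor.map_add, map_add, map_add, Matrix.add_apply, hf, hg, Matrix.add_apply,
      ite_add_ite, add_zero]
  | smul r m =>
    rw [Functor.map_smul, map_smul, map_smul, Matrix.smul_apply, Matrix.smul_apply,
      preTop_map_movieHom, homMatrix_movieHom m, ← smul_zero r, ← smul_ite]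
    exact congrArg (r • ·) ((congrFun₂ (homMatrix_movieHom (X := (preTop D).obj X)
      (Y := (preTop D).obj Y) (m.glueTop D.diagram)) σ τ).trans
        (m.glueTop_matrix D.diagram σ τ))

theorem homMatrix_preBot (D : GradedDiagram n) {X Y : PreCob n} (f : X ⟶ Y)
    (σ : (preDiagram ((preBot D).obj X)).Coloring) (τ : (preDiagram ((preBot D).obj Y)).Coloring) :
    homMatrix ((preBot D).map f) σ τ =
      if Diagram.Coloring.bot (a := preDiagram X) (b := D.diagram) σ =
          Diagram.Coloring.bot (a := preDiagram Y) (b := D.diagram) τ then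
        homMatrix f (Diagram.Coloring.top (a := preDiagram X) (b := D.diagram) σ)
          (Diagram.Coloring.top (a := preDiagram Y) (b := D.diagram) τ)
      else 0 := by
  induction f using preCob_induction with
  | zero => simp only [Functor.map_zero, map_zero, Matrix.zero_apply, ite_self]
  | add f g hf hg =>
    rw [Functor.map_add, map_add, map_add, Matrix.add_apply, hf, hg, Matrix.add_apply,
      ite_add_ite, add_zero]
  | smul r m =>
    rw [Functor.map_smul, map_smul, map_smul, Matrix.smul_apply, Matrix.smul_apply,
      preBot_map_movieHom, homMatrix_movieHom m, ← smul_zero r, ← smul_ite]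
    exact congrArg (r • ·) ((congrFun₂ (homMatrix_movieHom (X := (preBot D).obj X)
      (Y := (preBot D).obj Y) (m.glueBot D.diagram)) σ τ).trans
        (m.glueBot_matrix D.diagram σ τ))

theorem homMatrix_lin {a b : Diagram n} (p q : ℤ) (m : Movie a b) :
    homMatrix (lin p q m) = m.matrix :=
  homMatrix_movieHom (X := Free.of R ⟨a, p⟩) (Y := Free.of R ⟨b, q⟩) m

theorem Rel.homMatrix_eq {X Y : PreCob n} {f g : X ⟶ Y} (h : Rel n f g) :
    homMatrix f = homMatrix g := by
  induction h with
  | equivalent _ _ m m' h => rw [homMatrix_lin, homMatrix_lin, h.matrix_eq]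
  | sphere => exact (homMatrix_lin _ _ _).trans (CircleSite.sphere_matrix.trans (map_zero _).symm)
  | sphere_dot _ p q =>
    exact (homMatrix_lin _ _ _).trans
      (CircleSite.sphere_dot_matrix.trans (homMatrix_lin p q .nil).symm)
  | sphere_dot_dot =>
    exact (homMatrix_lin _ _ _).trans (CircleSite.sphere_dot_dot_matrix.trans (map_zero _).symm)
  | sphere_dot_dot_dot _ p q =>
    rw [map_smul, alpha_smul]
    exact (homMatrix_lin _ _ _).trans
      (CircleSite.sphere_dot_dot_dot_matrix.trans (homMatrix_lin p q .nil).symm)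
  | neck s =>
    rw [map_add]
    simp only [homMatrix_lin, Movie.matrix_comp]
    exact CircleSite.neck_matrix.symm
  | refl f => rfl
  | symm _ ih => exact ih.symm
  | trans _ _ ih ih' => exact ih.trans ih'
  | add _ _ ih ih' => rw [map_add, map_add, ih, ih']
  | smul r _ ih => rw [map_smul, map_smul, ih]
  | comp_left f _ ih => rw [homMatrix_comp, homMatrix_comp, ih]
  | comp_right g _ ih => rw [homMatrix_comp, homMatrix_comp, ih]
  | glueTop D _ ih =>
    ext σ τ
    rw [homMatrix_preTop, homMatrix_preTop, ih]
  | glueBot D _ ih =>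
    ext σ τ
    rw [homMatrix_preBot, homMatrix_preBot, ih]

theorem homMatrix_eq_zero {X Y : PreCob n} (f : X ⟶ Y)
    {σ : (preDiagram X).Coloring} {τ : (preDiagram Y).Coloring} {j : Fin n}
    (h : σ.1 ((preDiagram X).firstPt j) ≠ τ.1 ((preDiagram Y).firstPt j)) :
    homMatrix f σ τ = 0 := by
  induction f using preCob_induction with
  | zero => simp
  | add f g hf hg => rw [map_add, Matrix.add_apply, hf, hg, add_zero]
  | smul r m =>
    rw [map_smul, Matrix.smul_apply, homMatrix_movieHom,
      of_not_not fun h' => h (m.eq_of_matrix_ne_zero h' j).1, smul_zero]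

/-- The colouring of the identity diagram in which only the strand `i` has the colour `true`. -/
def strandColoring (i : Fin n) : (one n).Coloring := ⟨fun p => p.1.2 == i, by
  rintro p q ⟨l, L, hL, -⟩
  simp [one] at hL⟩

theorem homMatrix_comp_strandColoring {a : Diagram n} {i j : Fin n} (hij : i ≠ j)
    (ha : a.Joined (a.firstPt i) (a.firstPt j)) {p q : ℤ}
    (f : Free.of R (⟨one n, p⟩ : GradedDiagram n) ⟶ Free.of R ⟨a, q⟩)
    (g : Free.of R (⟨a, q⟩ : GradedDiagram n) ⟶ Free.of R ⟨one n, p⟩) :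
    homMatrix (f ≫ g) (strandColoring i) (strandColoring i) = 0 := by
  rw [homMatrix_comp]
  refine Finset.sum_eq_zero fun τ _ => ?_
  obtain ⟨k, hk⟩ : ∃ k, (strandColoring i).1 ((one n).firstPt k) ≠ τ.1 (a.firstPt k) := by
    by_contra! h
    have hi : (strandColoring i).1 ((one n).firstPt i) = true := beq_self_eq_true _
    have hj : (strandColoring i).1 ((one n).firstPt j) = false :=
      beq_eq_false_iff_ne.2 fun h => hij (Fin.ext h).symm
    exact Bool.noConfusion (hi.symm.trans ((h i).trans ((τ.2 _ _ ha).trans ((h j).symm.trans hj))))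
  exact mul_eq_zero_of_left (homMatrix_eq_zero f hk) _

theorem Cob.comp_ne_id {a : Diagram n} {i j : Fin n} (hij : i ≠ j)
    (ha : a.Joined (a.firstPt i) (a.firstPt j)) (p q : ℤ)
    (f : Cob.obj (one n) p ⟶ Cob.obj a q) (g : Cob.obj a q ⟶ Cob.obj (one n) p) : f ≫ g ≠ 𝟙 _ := by
  obtain ⟨f, rfl⟩ := (Quotient.functor (rel n)).map_surjective f
  obtain ⟨g, rfl⟩ := (Quotient.functor (rel n)).map_surjective g
  intro h
  have hfg : (Quotient.functor (rel n)).map (f ≫ g) =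
      (Quotient.functor (rel n)).map (lin p p .nil) :=
    ((Quotient.functor (rel n)).map_comp f g).trans h
  have entry := homMatrix_comp_strandColoring hij ha f g
  rw [((Quotient.functor_map_eq_iff (rel n) _ _).1 hfg).homMatrix_eq, homMatrix_lin] at entry
  exact one_ne_zero ((Matrix.one_apply_eq _).symm.trans entry)

/-! ### Equivalent movies -/

namespace Movie

variable {a b c : Diagram n}

theorem component_eq {m : Movie a b} {p q : m.Pt} (h : m.Joined p q) :
    m.component p = m.component q := Quot.sound h

theorem component_ofStep {s : Step a b} {p : a.Pt} {q : b.Pt} (h : s.Matches p q) :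
    (ofStep s).component ((ofStep s).first p) = (ofStep s).component ((ofStep s).last q) :=
  component_eq (m := ofStep s) ⟨p, rfl, h⟩

theorem equivalent_of_equiv {m m' : Movie a b} (φ : m.Component ≃ m'.Component)
    (hfirst : ∀ p, φ (m.component (m.first p)) = m'.component (m'.first p))
    (hlast : ∀ q, φ (m.component (m.last q)) = m'.component (m'.last q))
    (hchi : ∀ c, m.chi (m.component · = c) = m'.chi (m'.component · = φ c))
    (hdots : ∀ c, m.dots (m.component · = c) = m'.dots (m'.component · = φ c)) :
    m.Equivalent m' :=
  ⟨φ, hfirst, hlast, hchi, hdots⟩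

/-- The movie with two steps. -/
def twoStep (s : Step a b) (t : Step b c) : Movie a c := (ofStep s).snoc t

section

variable (s : Step a b) (t : Step b c)

/-- The component of a point of the first of the three slices. -/
def startClass (p : a.Pt) : (twoStep s t).Component := (twoStep s t).component (.inl (.inl p))

/-- The component of a point of the second of the three slices. -/
def midClass (p : b.Pt) : (twoStep s t).Component := (twoStep s t).component (.inl (.inr p))

/-- The component of a point of the last of the three slices. -/
def endClass (p : c.Pt) : (twoStep s t).Component := (twoStep s t).component (.inr p)

variable {s t}

theorem startClass_eq {p q : a.Pt} (h : a.Joined p q) : startClass s t p = startClass s t q :=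
  component_eq (m := twoStep s t) h

theorem endClass_eq {p q : c.Pt} (h : c.Joined p q) : endClass s t p = endClass s t q :=
  component_eq (m := twoStep s t) h

theorem startClass_eq_midClass {p : a.Pt} {q : b.Pt} (h : s.Matches p q) :
    startClass s t p = midClass s t q :=
  component_eq (m := twoStep s t) ⟨p, rfl, h⟩

theorem midClass_eq_endClass {p : b.Pt} {q : c.Pt} (h : t.Matches p q) :
    midClass s t p = endClass s t q :=
  component_eq (m := twoStep s t) ⟨p, rfl, h⟩

theorem class_cases {motive : (twoStep s t).Component → Prop}
    (start : ∀ p, motive (startClass s t p)) (mid : ∀ p, motive (midClass s t p))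
    (last : ∀ p, motive (endClass s t p)) (x : (twoStep s t).Component) : motive x := by
  obtain ⟨(p | p) | p⟩ := x
  exacts [start p, mid p, last p]

/-- Functions on the three slices that are constant along arcs and vertical segments induce a
function on the components. -/
def liftClass {X : Type} (f : a.Pt → X) (g : b.Pt → X) (h : c.Pt → X)
    (hf : ∀ p q, a.Joined p q → f p = f q) (hg : ∀ p q, b.Joined p q → g p = g q)
    (hh : ∀ p q, c.Joined p q → h p = h q) (hs : ∀ p q, s.Matches p q → f p = g q)
    (ht : ∀ p q, t.Matches p q → g p = h q) : (twoStep s t).Component → X :=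
  Quot.lift (Sum.elim (Sum.elim f g) h) <| by
    rintro ((p | p) | p) ((q | q) | q) hpq
    · exact hf p q hpq
    · obtain ⟨_, rfl, hpq⟩ := hpq
      exact hs _ _ hpq
    · obtain ⟨_, ⟨⟩, _⟩ := hpq
    · exact hpq.elim
    · exact hg p q hpq
    · obtain ⟨_, ⟨⟩, hpq⟩ := hpq
      exact ht _ _ hpq
    · exact hpq.elim
    · exact hpq.elim
    · exact hh p q hpq

open Classical in
theorem chi_twoStep (x : (twoStep s t).Component) :
    (twoStep s t).chi (fun p => (twoStep s t).component p = x) =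
      (if s.Meets (startClass s t · = x) (midClass s t · = x) then s.event.chi else 0) +
        if t.Meets (midClass s t · = x) (endClass s t · = x) then t.event.chi else 0 :=
  congrArg (· + _) (zero_add _)

open Classical in
theorem dots_twoStep (x : (twoStep s t).Component) :
    (twoStep s t).dots (fun p => (twoStep s t).component p = x) =
      (if s.Meets (startClass s t · = x) (midClass s t · = x) then s.event.dots else 0) +
        if t.Meets (midClass s t · = x) (endClass s t · = x) then t.event.dots else 0 :=
  congrArg (· + _) (zero_add _)

end

end Movie

theorem Step.meets_inl {a b : Diagram n} (s : Step a b) {z : ℕ × ℕ} (h : s.event.site = .inl z)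
    {p : a.Pt} (hp : p.1 = (s.u.length + z.1, z.2)) (A : a.Pt → Prop) (B : b.Pt → Prop) :
    s.Meets A B ↔ A p := by
  unfold Meets
  simp only [h, ← hp]
  exact exists_eq_and_iff p A

theorem Step.matches_iff_of_length {a b : Diagram n} (s : Step a b) {u x y : ℕ}
    (hu : s.u.length = u) (hx : s.x.length = x) (hy : s.y.length = y) {p : a.Pt} {q : b.Pt} :
    s.Matches p q ↔ p.1.2 = q.1.2 ∧
      (p.1.1 = q.1.1 ∧ p.1.1 ≤ u ∨ u + x ≤ p.1.1 ∧ p.1.1 + y = q.1.1 + x) := by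
  subst hu hx hy
  refine and_congr_right' (or_congr_right ⟨fun ⟨r, _, _⟩ => ?_, fun ⟨_, _⟩ => ?_⟩)
  · omega
  · exact ⟨p.1.1 - (s.u.length + s.x.length), by omega, by omega⟩

/-- A dot in a point of the diagram. -/
def dotStep (a : Diagram n) (p : a.Pt) : Step a a where
  u := a.word.take p.1.1
  v := a.word.drop p.1.1
  x := []
  y := []
  event := .dot p.1.2
  src := by simp
  tgt := by simp
  valid := p.2.2

namespace Movie

variable {a b : Diagram n}

theorem dotStep_matches {p q r : a.Pt} : (dotStep a p).Matches q r ↔ q = r := by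
  constructor
  · rintro ⟨h, ⟨h', -⟩ | ⟨k, h', h''⟩⟩
    · exact Subtype.ext (Prod.ext h' h)
    · exact Subtype.ext (Prod.ext (h'.trans h''.symm) h)
  · rintro rfl
    refine ⟨rfl, (le_total q.1.1 (dotStep a p).u.length).imp (⟨rfl, ·⟩) fun h => ?_⟩
    obtain ⟨k, hk⟩ := Nat.exists_eq_add_of_le h
    exact ⟨k, hk, hk⟩

theorem dotStep_meets (p : a.Pt) (A B : a.Pt → Prop) : (dotStep a p).Meets A B ↔ A p :=
  (dotStep a p).meets_inl rfl (Prod.ext (by simp [dotStep, p.2.1]) rfl) A B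

theorem chi_dotStep (p : a.Pt) : (dotStep a p).event.chi = 0 := rfl

theorem dots_dotStep (p : a.Pt) : (dotStep a p).event.dots = 1 := rfl

theorem chi_snoc_dotStep (m : Movie a b) (p : b.Pt) (S : (m.snoc (dotStep b p)).Pt → Prop) :
    (m.snoc (dotStep b p)).chi S = m.chi fun x => S (.inl x) :=
  (congrArg (_ + ·) (ite_self (0 : ℤ))).trans (add_zero _)

open Classical in
theorem dots_snoc_dotStep (m : Movie a b) (p : b.Pt) (S : (m.snoc (dotStep b p)).Pt → Prop) :
    (m.snoc (dotStep b p)).dots S =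
      (m.dots fun x => S (.inl x)) + if S (.inl (m.last p)) then 1 else 0 :=
  congrArg (_ + ·) (if_congr (dotStep_meets _ _ _) rfl rfl)

/-- The components of the surface do not depend on the place of the dot. -/
def dotMoveEquiv (m : Movie a b) (p q : b.Pt) :
    (m.snoc (dotStep b p)).Component ≃ (m.snoc (dotStep b q)).Component :=
  Quot.congrRight <| by
    rintro (x | x) (y | y)
    · exact Iff.rfl
    · simp only [Joined, dotStep_matches]
    · exact Iff.rfl
    · exact Iff.rfl

open Classical in
theorem equivalent_dot_move (m : Movie a b) {p q : b.Pt}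
    (h : m.component (m.last p) = m.component (m.last q)) :
    (m.snoc (dotStep b p)).Equivalent (m.snoc (dotStep b q)) := by
  have component_iff (x : (m.snoc (dotStep b p)).Pt) (c : (m.snoc (dotStep b p)).Component) :
      ((m.snoc (dotStep b p)).component x = c) =
        ((m.snoc (dotStep b q)).component x = m.dotMoveEquiv p q c) :=
    propext (m.dotMoveEquiv p q).injective.eq_iff.symm
  have last_eq : (m.snoc (dotStep b q)).component (.inl (m.last p)) =
      (m.snoc (dotStep b q)).component (.inl (m.last q)) :=
    congrArg (Quot.map Sum.inl (fun _ _ h => h) : m.Component → (m.snoc (dotStep b q)).Component) h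
  refine ⟨m.dotMoveEquiv p q, fun _ => rfl, fun _ => rfl, fun c => ?_, fun c => ?_⟩
  · rw [chi_snoc_dotStep, chi_snoc_dotStep]
    exact congrArg m.chi (funext fun x => component_iff (.inl x) c)
  · rw [dots_snoc_dotStep, dots_snoc_dotStep]
    refine congrArg₂ (· + ·) (congrArg m.dots (funext fun x => component_iff (.inl x) c))
      (if_congr ?_ rfl rfl)
    exact (iff_of_eq (component_iff (.inl (m.last p)) c)).trans (Eq.congr last_eq rfl)

/-- The components of the surface do not depend on whether the dot precedes the step. -/
def dotCommEquiv (s : Step a b) (p : a.Pt) (q : b.Pt) :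
    (twoStep (dotStep a p) s).Component ≃ (twoStep s (dotStep b q)).Component where
  toFun := liftClass (startClass _ _) (startClass _ _) (endClass _ _)
    (fun _ _ => startClass_eq) (fun _ _ => startClass_eq) (fun _ _ => endClass_eq)
    (fun _ _ h => congrArg _ (dotStep_matches.1 h))
    (fun _ _ h => (startClass_eq_midClass h).trans (midClass_eq_endClass (dotStep_matches.2 rfl)))
  invFun := liftClass (startClass _ _) (endClass _ _) (endClass _ _)
    (fun _ _ => startClass_eq) (fun _ _ => endClass_eq) (fun _ _ => endClass_eq)
    (fun _ _ h => (startClass_eq_midClass (dotStep_matches.2 rfl)).trans (midClass_eq_endClass h))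
    (fun _ _ h => congrArg _ (dotStep_matches.1 h))
  left_inv := class_cases (fun _ => rfl)
    (fun _ => startClass_eq_midClass (dotStep_matches.2 rfl)) (fun _ => rfl)
  right_inv := class_cases (fun _ => rfl)
    (fun _ => (midClass_eq_endClass (dotStep_matches.2 rfl)).symm) (fun _ => rfl)

open Classical in
theorem equivalent_dot_comm (s : Step a b) {p : a.Pt} {q : b.Pt} (h : s.Matches p q) :
    (twoStep (dotStep a p) s).Equivalent (twoStep s (dotStep b q)) := by
  let φ := dotCommEquiv s p q
  have φ_eq (x y) : (φ x = φ y) = (x = y) := propext φ.injective.eq_iff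
  have mid (x : a.Pt) : startClass s (dotStep b q) x = φ (midClass (dotStep a p) s x) :=
    congrArg φ (startClass_eq_midClass (dotStep_matches.2 rfl))
  have last (x : b.Pt) : midClass s (dotStep b q) x = φ (endClass (dotStep a p) s x) :=
    midClass_eq_endClass (dotStep_matches.2 rfl)
  have dot : endClass (dotStep a p) s q = startClass (dotStep a p) s p :=
    ((startClass_eq_midClass (dotStep_matches.2 rfl)).trans (midClass_eq_endClass h)).symm
  refine equivalent_of_equiv φ (fun _ => rfl) (fun _ => rfl) (fun c => ?_) fun c => ?_
  · rw [chi_twoStep, chi_twoStep]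
    simp only [mid, last, φ_eq, chi_dotStep, ite_self, zero_add, add_zero]
  · rw [dots_twoStep, dots_twoStep]
    simp only [dotStep_meets, dot, mid, last, φ_eq, dots_dotStep]
    exact add_comm _ _

open Classical in
/-- A step that is undone by the next one: `f` sends every point after the step `s` to the point
before it on the same vertical segment, and `t` runs back along these segments. -/
theorem equivalent_nil (s : Step a b) (t : Step b a) (f : b.Pt → a.Pt)
    (hs : ∀ p q, s.Matches p q ↔ p = f q) (ht : ∀ q p, t.Matches q p → f q = p)
    (ht' : ∀ p, ∃ q, t.Matches q p)
    (hf : ∀ q q', b.Joined q q' →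
      (nil : Movie a a).component (f q) = (nil : Movie a a).component (f q'))
    (hmeets : ∀ A, s.Meets A (A ∘ f) ↔ t.Meets (A ∘ f) A)
    (hchi : s.event.chi + t.event.chi = 0) (hdots : s.event.dots = 0 ∧ t.event.dots = 0) :
    (twoStep s t).Equivalent nil := by
  have mid (q : b.Pt) : startClass s t (f q) = midClass s t q :=
    startClass_eq_midClass ((hs _ _).2 rfl)
  have last (p : a.Pt) : startClass s t p = endClass s t p := by
    obtain ⟨q, hq⟩ := ht' p
    rw [← midClass_eq_endClass hq, ← mid, ht q p hq]
  have start (p p' : a.Pt) (h : a.Joined p p') :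
      (nil : Movie a a).component p = (nil : Movie a a).component p' := Quot.sound h
  let φ : (twoStep s t).Component ≃ (nil : Movie a a).Component :=
    { toFun := liftClass (nil : Movie a a).component (fun q => (nil : Movie a a).component (f q))
        (nil : Movie a a).component start
        hf start (fun _ _ h => congrArg _ ((hs _ _).1 h))
        (fun _ _ h => congrArg _ (ht _ _ h))
      invFun := Quot.lift (startClass s t) fun _ _ => startClass_eq
      left_inv := class_cases (fun _ => rfl) mid last
      right_inv := fun x => by induction x using Quot.ind; rfl }
  refine equivalent_of_equiv φ (fun _ => rfl) (fun _ => rfl) (fun c => ?_) fun c => ?_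
  · rw [chi_twoStep]
    have meets_iff := hmeets (startClass s t · = c)
    simp only [Function.comp_def, mid] at meets_iff
    simp only [← last, if_congr meets_iff rfl rfl]
    split_ifs
    exacts [hchi, rfl]
  · rw [dots_twoStep]
    rw [hdots.1, hdots.2, ite_self, ite_self]
    rfl

end Movie

/-! ### Movies between `e₁` and `e₁ ⊗ e₁` -/

/-- The saddle at the top of `e₁`, from `e₁` to `e₁ ⊗ e₁`. -/
def saddleTop : Step e₁ (e₁.tensor e₁) :=
  ⟨[], e₁.word, [], _, .saddle 0, rfl, rfl, trivial⟩

/-- The saddle at the bottom of `e₁`, from `e₁` to `e₁ ⊗ e₁`. -/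
def saddleBot : Step e₁ (e₁.tensor e₁) :=
  ⟨e₁.word, [], [], _, .saddle 0, rfl, rfl, trivial⟩

/-- The death of the circle of `e₁ ⊗ e₁`. -/
def deathStep : Step (e₁.tensor e₁) e₁ :=
  ⟨[.cup 0], [.cap 0], _, [], .death 0, rfl, rfl, trivial⟩

/-- The birth of a circle in the middle of `e₁`. -/
def birthStep : Step e₁ (e₁.tensor e₁) :=
  ⟨[.cup 0], [.cap 0], [], _, .birth 0, rfl, rfl, trivial⟩

/-- The left end point of the top arc of `e₁`. -/
def topPoint : e₁.Pt := ⟨(0, 0), by decide, by decide⟩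

/-- The left end point of the bottom arc of `e₁`. -/
def botPoint : e₁.Pt := ⟨(2, 0), by decide, by decide⟩

/-- The left end point of the top arc of `e₁ ⊗ e₁`. -/
def topPoint₂ : (e₁.tensor e₁).Pt := ⟨(0, 0), by decide, by decide⟩

/-- A point on the circle of `e₁ ⊗ e₁`. -/
def midPoint₂ : (e₁.tensor e₁).Pt := ⟨(2, 0), by decide, by decide⟩

/-- The left end point of the bottom arc of `e₁ ⊗ e₁`. -/
def botPoint₂ : (e₁.tensor e₁).Pt := ⟨(4, 0), by decide, by decide⟩

theorem isPt_e₁ {l j : ℕ} : e₁.IsPt (l, j) ↔ (l = 0 ∨ l = 2) ∧ j < 2 := by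
  constructor
  · rintro ⟨hl, hj⟩
    obtain rfl | rfl | rfl : l = 0 ∨ l = 1 ∨ l = 2 := by
      change l ≤ 2 at hl
      omega
    exacts [⟨.inl rfl, hj⟩, (Nat.not_lt_zero j hj).elim, ⟨.inr rfl, hj⟩]
  · rintro ⟨rfl | rfl, hj⟩
    exacts [⟨Nat.zero_le _, hj⟩, ⟨le_rfl, hj⟩]

theorem isPt_e₁_tensor_e₁ {l j : ℕ} :
    (e₁.tensor e₁).IsPt (l, j) ↔ (l = 0 ∨ l = 2 ∨ l = 4) ∧ j < 2 := by
  constructor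
  · rintro ⟨hl, hj⟩
    obtain rfl | rfl | rfl | rfl | rfl : l = 0 ∨ l = 1 ∨ l = 2 ∨ l = 3 ∨ l = 4 := by
      change l ≤ 4 at hl
      omega
    exacts [⟨.inl rfl, hj⟩, (Nat.not_lt_zero j hj).elim, ⟨.inr (.inl rfl), hj⟩,
      (Nat.not_lt_zero j hj).elim, ⟨.inr (.inr rfl), hj⟩]
  · rintro ⟨rfl | rfl | rfl, hj⟩
    exacts [⟨Nat.zero_le _, hj⟩, ⟨(by decide : 2 ≤ 4), hj⟩, ⟨le_rfl, hj⟩]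

theorem line_e₁ (p : e₁.Pt) : p.1.1 = 0 ∨ p.1.1 = 2 := (isPt_e₁.1 p.2).1

theorem line_e₁_tensor_e₁ (p : (e₁.tensor e₁).Pt) : p.1.1 = 0 ∨ p.1.1 = 2 ∨ p.1.1 = 4 :=
  (isPt_e₁_tensor_e₁.1 p.2).1

theorem line_eq_of_joined {p q : (e₁.tensor e₁).Pt} (h : (e₁.tensor e₁).Joined p q) :
    p.1.1 = q.1.1 := by
  obtain ⟨l, L, -, h⟩ := h
  have hp := line_e₁_tensor_e₁ p
  have hq := line_e₁_tensor_e₁ q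
  have := h.le
  omega

theorem component_e₁_eq {p q : e₁.Pt} (h : p.1.1 = q.1.1) :
    (Movie.nil : Movie e₁ e₁).component p = (Movie.nil : Movie e₁ e₁).component q := by
  have left_eq_right {l : ℕ} (hl : e₁.IsPt (l, 0)) (hl' : e₁.IsPt (l, 1)) :
      (Movie.nil : Movie e₁ e₁).component ⟨(l, 0), hl⟩ =
        (Movie.nil : Movie e₁ e₁).component ⟨(l, 1), hl'⟩ := by
    apply Quot.sound
    obtain rfl | rfl := (isPt_e₁.1 hl).1
    exacts [⟨0, .cup 0, rfl, .cup_turn 0⟩, ⟨1, .cap 0, rfl, .cap_turn 0⟩]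
  obtain ⟨⟨l, j⟩, hp⟩ := p
  obtain ⟨⟨l', k⟩, hq⟩ := q
  obtain rfl : l = l' := h
  obtain rfl | rfl : j = 0 ∨ j = 1 := by have := (isPt_e₁.1 hp).2; omega
  all_goals obtain rfl | rfl : k = 0 ∨ k = 1 := by have := (isPt_e₁.1 hq).2; omega
  exacts [rfl, left_eq_right hp hq, (left_eq_right hq hp).symm, rfl]

/-- The projection of `e₁ ⊗ e₁` to `e₁` that moves the circle to the top arc. -/
def retractTop (q : (e₁.tensor e₁).Pt) : e₁.Pt :=
  ⟨(q.1.1 - 2, q.1.2), isPt_e₁.2 ⟨by have := line_e₁_tensor_e₁ q; omega,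
    (isPt_e₁_tensor_e₁.1 q.2).2⟩⟩

/-- The projection of `e₁ ⊗ e₁` to `e₁` that moves the circle to the bottom arc. -/
def retractBot (q : (e₁.tensor e₁).Pt) : e₁.Pt :=
  ⟨(min q.1.1 2, q.1.2), isPt_e₁.2 ⟨by have := line_e₁_tensor_e₁ q; omega,
    (isPt_e₁_tensor_e₁.1 q.2).2⟩⟩

theorem eq_retractTop_iff {p : e₁.Pt} {q : (e₁.tensor e₁).Pt} :
    p = retractTop q ↔ p.1.1 = q.1.1 - 2 ∧ p.1.2 = q.1.2 :=
  Subtype.ext_iff.trans Prod.ext_iff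

theorem eq_retractBot_iff {p : e₁.Pt} {q : (e₁.tensor e₁).Pt} :
    p = retractBot q ↔ p.1.1 = min q.1.1 2 ∧ p.1.2 = q.1.2 :=
  Subtype.ext_iff.trans Prod.ext_iff

theorem saddleTop_matches {p : e₁.Pt} {q : (e₁.tensor e₁).Pt} :
    saddleTop.Matches p q ↔ p = retractTop q := by
  rw [saddleTop.matches_iff_of_length (u := 0) (x := 0) (y := 2) rfl rfl rfl, eq_retractTop_iff]
  have := line_e₁_tensor_e₁ q
  omega

theorem saddleBot_matches {p : e₁.Pt} {q : (e₁.tensor e₁).Pt} :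
    saddleBot.Matches p q ↔ p = retractBot q := by
  rw [saddleBot.matches_iff_of_length (u := 2) (x := 0) (y := 2) rfl rfl rfl, eq_retractBot_iff]
  have := line_e₁ p
  have := line_e₁_tensor_e₁ q
  omega

theorem deathStep_matches {q : (e₁.tensor e₁).Pt} {p : e₁.Pt} :
    deathStep.Matches q p ↔ q.1.2 = p.1.2 ∧ (q.1.1 = 0 ∧ p.1.1 = 0 ∨ q.1.1 = 4 ∧ p.1.1 = 2) := by
  rw [deathStep.matches_iff_of_length (u := 1) (x := 2) (y := 0) rfl rfl rfl]
  have := line_e₁ p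
  have := line_e₁_tensor_e₁ q
  omega

theorem exists_deathStep_matches (p : e₁.Pt) : ∃ q, deathStep.Matches q p := by
  obtain hp | hp := line_e₁ p
  exacts [
    ⟨⟨(0, p.1.2), isPt_e₁_tensor_e₁.2 (by simp [(isPt_e₁.1 p.2).2])⟩,
      deathStep_matches.2 (by simp [hp])⟩,
    ⟨⟨(4, p.1.2), isPt_e₁_tensor_e₁.2 (by simp [(isPt_e₁.1 p.2).2])⟩,
      deathStep_matches.2 (by simp [hp])⟩]

theorem deathStep_meets (A : (e₁.tensor e₁).Pt → Prop) (B : e₁.Pt → Prop) :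
    deathStep.Meets A B ↔ A midPoint₂ :=
  deathStep.meets_inl rfl rfl A B

theorem equivalent_saddleTop_death : (Movie.twoStep saddleTop deathStep).Equivalent Movie.nil :=
  Movie.equivalent_nil _ _ retractTop (fun _ _ => saddleTop_matches)
    (fun q p h => by
      have := deathStep_matches.1 h
      exact (eq_retractTop_iff.2 (by omega)).symm)
    exists_deathStep_matches
    (fun _ _ h => component_e₁_eq (congrArg (· - 2) (line_eq_of_joined h)))
    (fun A => (saddleTop.meets_inl rfl (p := topPoint) rfl A _).trans
      (deathStep_meets (A ∘ retractTop) A).symm)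
    rfl ⟨rfl, rfl⟩

theorem equivalent_saddleBot_death : (Movie.twoStep saddleBot deathStep).Equivalent Movie.nil :=
  Movie.equivalent_nil _ _ retractBot (fun _ _ => saddleBot_matches)
    (fun q p h => by
      have := deathStep_matches.1 h
      exact (eq_retractBot_iff.2 (by omega)).symm)
    exists_deathStep_matches
    (fun _ _ h => component_e₁_eq (congrArg (min · 2) (line_eq_of_joined h)))
    (fun A => (saddleBot.meets_inl rfl (p := botPoint) rfl A _).trans
      (deathStep_meets (A ∘ retractBot) A).symm)
    rfl ⟨rfl, rfl⟩

/-! ### Relations in `Cob 2` -/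

namespace Cob

/-- The morphism of `Cob n` given by a movie, between the diagrams in `q`-degrees `p` and `q`. -/
def cls {a b : Diagram n} (p q : ℤ) (m : Movie a b) : Cob.obj a p ⟶ Cob.obj b q :=
  (Quotient.functor (rel n)).map (lin p q m)

variable {a b c : Diagram n}

theorem ofMovie_one (p q : ℤ) (m : Movie a b) :
    Cob.ofMovie (X := Cob.obj a p) (Y := Cob.obj b q) 1 m = cls p q m :=
  congrArg (Quotient.functor (rel n)).map (one_smul R (lin p q m))

theorem cls_comp (p q r : ℤ) (m : Movie a b) (m' : Movie b c) :
    cls p q m ≫ cls q r m' = cls p r (m.comp m') :=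
  ((Quotient.functor (rel n)).map_comp (lin p q m) (lin q r m')).symm.trans
    (congrArg (Quotient.functor (rel n)).map
      ((Free.embedding R (GradedDiagram n)).map_comp
        (X := ⟨a, p⟩) (Y := ⟨b, q⟩) (Z := ⟨c, r⟩) m m').symm)

theorem cls_nil (p : ℤ) : cls p p (Movie.nil : Movie a a) = 𝟙 (Cob.obj a p) :=
  (congrArg (Quotient.functor (rel n)).map
    ((Free.embedding R (GradedDiagram n)).map_id (⟨a, p⟩ : GradedDiagram n))).trans
    ((Quotient.functor (rel n)).map_id _)

theorem cls_eq_of_rel {p q : ℤ} {m : Movie a b}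
    {f : Free.of R (⟨a, p⟩ : GradedDiagram n) ⟶ Free.of R (⟨b, q⟩ : GradedDiagram n)}
    (h : Rel n (lin p q m) f) : cls p q m = (Quotient.functor (rel n)).map f :=
  CategoryTheory.Quotient.sound (rel n) h

theorem cls_eq_of_equivalent {m m' : Movie a b} (h : m.Equivalent m') (p q : ℤ) :
    cls p q m = cls p q m' := cls_eq_of_rel (Rel.equivalent p q m m' h)

theorem cls_comp_left (m : Movie a b) {m₂ m₂' : Movie b c}
    (h₂ : ∀ p q, cls p q m₂ = cls p q m₂') (p q : ℤ) :
    cls p q (m.comp m₂) = cls p q (m.comp m₂') := by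
  rw [← cls_comp p p q, h₂, cls_comp]

theorem cls_comp_right (m : Movie b c) {m₁ m₁' : Movie a b}
    (h₁ : ∀ p q, cls p q m₁ = cls p q m₁') (p q : ℤ) :
    cls p q (m₁.comp m) = cls p q (m₁'.comp m) := by
  rw [← cls_comp p p q, h₁, cls_comp]

theorem tensorLeft_cls (D : GradedDiagram n) (p q : ℤ) (m : Movie a b) :
    (Cob.tensorLeft D).map (cls p q m) = cls (D.deg + p) (D.deg + q) (m.glueTop D.diagram) :=
  congrArg (Quotient.functor (rel n)).map
    (preTop_map_movieHom D (X := Free.of R ⟨a, p⟩) (Y := Free.of R ⟨b, q⟩) m)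

theorem tensorRight_cls (D : GradedDiagram n) (p q : ℤ) (m : Movie a b) :
    (Cob.tensorRight D).map (cls p q m) = cls (p + D.deg) (q + D.deg) (m.glueBot D.diagram) :=
  congrArg (Quotient.functor (rel n)).map
    (preBot_map_movieHom D (X := Free.of R ⟨a, p⟩) (Y := Free.of R ⟨b, q⟩) m)

end Cob

open Cob

/-- The middle of `e₁`, where the circle of `e₁ ⊗ e₁` is inserted. -/
def midSite : CircleSite 2 := ⟨[.cup 0], [.cap 0], 0, e₁.isTangle, (e₁.tensor e₁).isTangle⟩

/-- The movie in which the circle of `e₁ ⊗ e₁` dies. -/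
def circleDeath : Movie (e₁.tensor e₁) e₁ := .ofStep deathStep

/-- The movie in which a circle is born in the middle of `e₁`. -/
def circleBirth : Movie e₁ (e₁.tensor e₁) := .ofStep birthStep

/-- The movie that puts a dot on the circle of `e₁ ⊗ e₁`. -/
def circleDot : Movie (e₁.tensor e₁) (e₁.tensor e₁) := .ofStep (dotStep _ midPoint₂)

/-- The movie in which the circle of `e₁ ⊗ e₁` dies and another one is born. -/
def circleSwap : Movie (e₁.tensor e₁) (e₁.tensor e₁) := circleDeath.comp circleBirth

theorem cls_neck (p q : ℤ) : cls p q (Movie.nil : Movie (e₁.tensor e₁) (e₁.tensor e₁)) =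
    cls p q (circleSwap.comp circleDot) + cls p q (circleDot.comp circleSwap) :=
  cls_eq_of_rel (Rel.neck midSite p q)

theorem cls_sphere_dot_dot (p q : ℤ) :
    cls p q (circleBirth.comp (circleDot.comp (circleDot.comp circleDeath))) = 0 :=
  cls_eq_of_rel (Rel.sphere_dot_dot midSite p q)

/-- What the top and the bottom arc of `e₁` have in common: a point `pt` of the arc in `e₁` and a
point `pt₂` of it in `e₁ ⊗ e₁`, and a saddle that splits the circle of `e₁ ⊗ e₁` off the arc. -/
structure Arc where
  saddle : Step e₁ (e₁.tensor e₁)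
  pt : e₁.Pt
  pt₂ : (e₁.tensor e₁).Pt
  saddle_death : (Movie.twoStep saddle deathStep).Equivalent .nil
  saddle_matches : saddle.Matches pt pt₂
  saddle_matches_mid : saddle.Matches pt midPoint₂
  death_matches : deathStep.Matches pt₂ pt
  birth_matches : birthStep.Matches pt pt₂

/-- The top arc of `e₁`. -/
def topArc : Arc where
  saddle := saddleTop
  pt := topPoint
  pt₂ := topPoint₂
  saddle_death := equivalent_saddleTop_death
  saddle_matches := saddleTop_matches.2 rfl
  saddle_matches_mid := saddleTop_matches.2 rfl
  death_matches := deathStep_matches.2 ⟨rfl, .inl ⟨rfl, rfl⟩⟩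
  birth_matches := ⟨rfl, .inl ⟨rfl, by decide⟩⟩

/-- The bottom arc of `e₁`. -/
def botArc : Arc where
  saddle := saddleBot
  pt := botPoint
  pt₂ := botPoint₂
  saddle_death := equivalent_saddleBot_death
  saddle_matches := saddleBot_matches.2 rfl
  saddle_matches_mid := saddleBot_matches.2 rfl
  death_matches := deathStep_matches.2 ⟨rfl, .inr ⟨rfl, rfl⟩⟩
  birth_matches := ⟨rfl, .inr ⟨1, rfl, rfl⟩⟩

namespace Arc

variable (A : Arc)

/-- The movie that splits the circle off the arc. -/
def split : Movie e₁ (e₁.tensor e₁) := .ofStep A.saddle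

/-- The movie that puts a dot on the arc. -/
def dot : Movie e₁ e₁ := .ofStep (dotStep _ A.pt)

/-- The movie that puts a dot on the arc in the presence of the circle. -/
def dot₂ : Movie (e₁.tensor e₁) (e₁.tensor e₁) := .ofStep (dotStep _ A.pt₂)

theorem cls_split_death (p q : ℤ) : cls p q (A.split.comp circleDeath) = cls p q .nil :=
  cls_eq_of_equivalent A.saddle_death p q

theorem cls_split_circleDot (p q : ℤ) :
    cls p q (A.split.comp circleDot) = cls p q (A.dot.comp A.split) := by
  have mid_eq : A.split.component (A.split.last midPoint₂) =
      A.split.component (A.split.last A.pt₂) :=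
    (Movie.component_ofStep A.saddle_matches_mid).symm.trans
      (Movie.component_ofStep A.saddle_matches)
  exact (cls_eq_of_equivalent (Movie.equivalent_dot_move A.split mid_eq) p q).trans
    (cls_eq_of_equivalent (Movie.equivalent_dot_comm A.saddle A.saddle_matches) p q).symm

theorem cls_dot₂_death (p q : ℤ) :
    cls p q (A.dot₂.comp circleDeath) = cls p q (circleDeath.comp A.dot) :=
  cls_eq_of_equivalent (Movie.equivalent_dot_comm deathStep A.death_matches) p q

theorem cls_dot_birth (p q : ℤ) :
    cls p q (A.dot.comp circleBirth) = cls p q (circleBirth.comp A.dot₂) :=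
  cls_eq_of_equivalent (Movie.equivalent_dot_comm birthStep A.birth_matches) p q

theorem cls_dot₂_swap (p q : ℤ) :
    cls p q (A.dot₂.comp circleSwap) = cls p q (circleSwap.comp A.dot₂) := by
  rw [circleSwap, ← Movie.comp_assoc, Movie.comp_assoc circleDeath,
    cls_comp_right circleBirth A.cls_dot₂_death, Movie.comp_assoc,
    cls_comp_left circleDeath A.cls_dot_birth]

theorem cls_split (p q : ℤ) : cls p q A.split =
    cls p q (circleBirth.comp circleDot) + cls p q (A.dot.comp circleBirth) := by
  have h₁ : cls p q (A.split.comp (circleSwap.comp circleDot)) =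
      cls p q (circleBirth.comp circleDot) := by
    rw [circleSwap, Movie.comp_assoc, ← Movie.comp_assoc A.split,
      cls_comp_right _ A.cls_split_death, Movie.nil_comp]
  have h₂ : cls p q (A.split.comp (circleDot.comp circleSwap)) =
      cls p q (A.dot.comp circleBirth) := by
    rw [← Movie.comp_assoc, cls_comp_right _ A.cls_split_circleDot, circleSwap, Movie.comp_assoc,
      ← Movie.comp_assoc A.split, cls_comp_left A.dot (cls_comp_right circleBirth
        A.cls_split_death), Movie.nil_comp]
  rw [← h₁, ← h₂, ← cls_comp p p q A.split, ← cls_comp p p q A.split, ← Preadditive.comp_add,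
    ← cls_neck, cls_comp]
  rfl

theorem cls_death_split (p q : ℤ) : cls p q (circleDeath.comp A.split) =
    cls p q (circleSwap.comp circleDot) + cls p q (A.dot₂.comp circleSwap) := by
  rw [← cls_comp p p q, A.cls_split, Preadditive.comp_add, cls_comp, cls_comp, circleSwap,
    Movie.comp_assoc, ← Movie.comp_assoc A.dot₂, cls_comp_right circleBirth A.cls_dot₂_death,
    Movie.comp_assoc]

theorem cls_dot_dot (p q : ℤ) : cls p q (A.dot.comp A.dot) =
    cls p q (circleBirth.comp (circleDot.comp (circleDot.comp (circleDot.comp circleDeath)))) := by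
  have h : cls p q (A.dot.comp A.dot) =
      cls p q (A.split.comp (circleDot.comp (circleDot.comp circleDeath))) := by
    symm
    rw [← Movie.comp_assoc, cls_comp_right _ A.cls_split_circleDot, Movie.comp_assoc]
    refine cls_comp_left A.dot (fun p q => ?_) p q
    rw [← Movie.comp_assoc, cls_comp_right _ A.cls_split_circleDot, Movie.comp_assoc,
      cls_comp_left A.dot A.cls_split_death]
    rfl
  rw [h, ← cls_comp p p q, A.cls_split, Preadditive.add_comp, cls_comp, cls_comp,
    Movie.comp_assoc, Movie.comp_assoc, ← cls_comp p p q A.dot, cls_sphere_dot_dot, comp_zero,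
    add_zero]

theorem swap_homotopy (s : ℤ) (p q r : ℤ) :
    (cls p q circleDot + -s • cls p q A.dot₂) ≫ cls q p circleSwap +
      cls p r circleSwap ≫ (cls r p circleDot + s • cls r p A.dot₂) = 𝟙 _ := by
  rw [← cls_nil, cls_neck]
  simp only [Preadditive.add_comp, Preadditive.comp_add, Preadditive.zsmul_comp,
    Preadditive.comp_zsmul, Preadditive.neg_comp, cls_comp, A.cls_dot₂_swap, neg_smul]
  abel

theorem death_homotopy (p q r : ℤ) :
    (cls p q circleDot + (-1 : ℤ) • cls p q A.dot₂) ≫ cls q p circleSwap +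
      cls p r circleDeath ≫ cls r p A.split = 𝟙 _ := by
  rw [← cls_nil, cls_neck]
  simp only [Preadditive.add_comp, Preadditive.neg_comp, cls_comp, A.cls_death_split, neg_smul,
    one_smul]
  abel

theorem zsmul_swap_homotopy {s : ℤ} (hs : s * s = 1) (p q r : ℤ) :
    (cls p q A.dot₂ + -s • cls p q circleDot) ≫ (-s • cls q p circleSwap) +
      (s • cls p r circleSwap) ≫ (cls r p A.dot₂ + s • cls r p circleDot) = 𝟙 _ := by
  rw [← A.swap_homotopy s p q r]
  simp only [Preadditive.add_comp, Preadditive.comp_add, Preadditive.zsmul_comp,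
    Preadditive.comp_zsmul, smul_add, smul_smul, neg_mul_neg, hs, one_smul]
  abel

theorem neg_death_homotopy (p q r : ℤ) :
    (cls p q A.dot₂ + (-1 : ℤ) • cls p q circleDot) ≫ ((-1 : ℤ) • cls q p circleSwap) +
      cls p r circleDeath ≫ cls r p A.split = 𝟙 _ := by
  rw [← A.death_homotopy p q r]
  simp only [Preadditive.add_comp, Preadditive.neg_comp, Preadditive.comp_neg, neg_smul, one_smul]
  abel

end Arc

theorem cls_dotTop_dotBot (p q : ℤ) :
    cls p q (dotTop.comp dotBot) = cls p q (dotBot.comp dotTop) :=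
  cls_eq_of_equivalent (Movie.equivalent_dot_comm (dotStep e₁ botPoint) (p := topPoint)
    (q := topPoint) (Movie.dotStep_matches.2 rfl)) p q

theorem cls_dotTop_dotTop (p q : ℤ) :
    cls p q (dotTop.comp dotTop) = cls p q (dotBot.comp dotBot) :=
  (topArc.cls_dot_dot p q).trans (botArc.cls_dot_dot p q).symm

theorem cls_saddle_dot (p q : ℤ) :
    cls p q (saddle.comp dotTop) = cls p q (saddle.comp dotBot) := by
  let x : (one 2).Pt := ⟨(0, 0), by decide, by decide⟩
  have first_eq_top : saddle.component (saddle.first x) =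
      saddle.component (saddle.last topPoint) :=
    Movie.component_eq (m := saddle) ⟨x, rfl, rfl, .inl ⟨rfl, by decide⟩⟩
  have first_eq_bot : saddle.component (saddle.first x) =
      saddle.component (saddle.last botPoint) :=
    Movie.component_eq (m := saddle) ⟨x, rfl, rfl, .inr ⟨0, rfl, rfl⟩⟩
  exact cls_eq_of_equivalent
    (Movie.equivalent_dot_move saddle (first_eq_top.symm.trans first_eq_bot)) p q

/-! ### The complex `P₂` -/

/-- Objects and morphisms of `Cob n` as families with one member and `1 × 1` matrices. -/
abbrev emb : Cob n ⥤ Mat_ (Cob n) := Mat_.embedding (Cob n)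

theorem mat_eq_emb {a b : Diagram n} (p q : ℤ) (m : Movie a b) : mat p q m = emb.map (cls p q m) :=
  congrArg emb.map (ofMovie_one p q m)

/-- The `q`-degree of the chain group in homological degree `k + 1`. -/
abbrev qdeg (k : ℕ) : ℤ := 2 * ((k : ℤ) + 1) - 1

/-- The sign of the dot on the bottom arc in the differential in homological degree `k + 1`. -/
def sign (k : ℕ) : ℤ := if Odd (k + 1) then -1 else 1

theorem sign_zero : sign 0 = -1 := rfl

theorem sign_succ (k : ℕ) : sign (k + 1) = -sign k := by
  by_cases h : Odd (k + 1) <;> simp [sign, Nat.odd_add_one (n := k + 1), h]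

theorem sign_mul_self (k : ℕ) : sign k * sign k = 1 := by
  rw [sign]
  split_ifs <;> rfl

/-- The differential in homological degree `0`. -/
def saddleDiff : obj (one 2) 0 ⟶ obj e₁ (qdeg 0) := cls _ _ saddle

/-- The differential in homological degree `k + 1`. -/
def dotDiff (k : ℕ) : obj e₁ (qdeg k) ⟶ obj e₁ (qdeg (k + 1)) :=
  cls _ _ dotTop + sign k • cls _ _ dotBot

theorem P₂d_zero : P₂d (.ofNat 0) = emb.map saddleDiff := mat_eq_emb _ _ _

theorem P₂d_succ (k : ℕ) : P₂d (.ofNat (k + 1)) = emb.map (dotDiff k) := by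
  have h : emb.map (dotDiff k) = mat (qdeg k) (qdeg (k + 1)) dotTop +
      sign k • mat (qdeg k) (qdeg (k + 1)) dotBot := by
    rw [mat_eq_emb, mat_eq_emb, dotDiff, Functor.map_add, Functor.map_zsmul]
    rfl
  rw [h, sign, P₂d]
  split_ifs
  · rw [neg_smul, one_smul, ← sub_eq_add_neg]
    rfl
  · rw [one_smul]
    rfl

theorem saddleDiff_comp : saddleDiff ≫ dotDiff 0 = 0 := by
  rw [dotDiff, sign_zero, neg_smul, one_smul, saddleDiff, Preadditive.comp_add,
    Preadditive.comp_neg, cls_comp, cls_comp, cls_saddle_dot, add_neg_cancel]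

theorem dotDiff_comp (k : ℕ) : dotDiff k ≫ dotDiff (k + 1) = 0 := by
  simp only [dotDiff, sign_succ, Preadditive.comp_add, Preadditive.add_comp,
    Preadditive.zsmul_comp, Preadditive.comp_zsmul, Preadditive.comp_neg, cls_comp,
    cls_dotTop_dotTop, cls_dotTop_dotBot, smul_add, neg_smul, smul_smul, sign_mul_self, one_smul]
  abel

theorem P₂d_comp (k : ℤ) : P₂d k ≫ P₂d (k + 1) = 0 := by
  match k with
  | .ofNat 0 =>
    have h := congrArg emb.map saddleDiff_comp
    rw [Functor.map_comp, Functor.map_zero, ← P₂d_zero, ← P₂d_succ] at h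
    exact h
  | .ofNat (k + 1) =>
    have h := congrArg emb.map (dotDiff_comp k)
    rw [Functor.map_comp, Functor.map_zero, ← P₂d_succ, ← P₂d_succ] at h
    exact h
  | .negSucc k => exact zero_comp

/-- The candidate for the universal projector on two strands. -/
def P₂ : Cpx 2 := CochainComplex.of P₂X P₂d P₂d_comp

theorem P₂_d (k : ℤ) : P₂.d k (k + 1) = P₂d k := CochainComplex.of_d _ _ _

theorem isZero_of_isEmpty (M : Mat_ (Cob n)) [IsEmpty M.ι] : IsZero M :=
  (IsZero.iff_id_eq_zero M).2 (funext fun i => isEmptyElim i)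

theorem isZero_P₂X {k : ℤ} (hk : k < 0) : IsZero (P₂X k) := by
  match k, hk with
  | .negSucc k, _ => exact @isZero_of_isEmpty 2 _ (inferInstanceAs (IsEmpty Empty))

theorem deg_P₂X_nonneg {k : ℤ} (hk : 0 < k) (i : (P₂X k).ι) : 0 ≤ ((P₂X k).X i).deg := by
  match k, hk with
  | .ofNat (k + 1), _ =>
    change (0 : ℤ) ≤ 2 * ((k : ℤ) + 1) - 1
    omega

/-! ### Degrees -/

theorem cls_mem_degreeZero {a b : Diagram n} {p q : ℤ} {m : Movie a b}
    (h : m.degree + (q - p) = 0) : cls p q m ∈ degreeZero (obj a p) (obj b q) := by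
  refine AddSubgroup.subset_closure ⟨0, m, ?_, ?_⟩
  · rw [Nat.cast_zero, mul_zero, sub_zero]
    exact h
  · rw [pow_zero]
    exact (ofMovie_one p q m).symm

theorem isDegreeZero_emb {X Y : Cob n} {f : X ⟶ Y} (h : f ∈ degreeZero X Y) :
    IsDegreeZero (emb.map f) := fun _ _ => h

theorem isDegreeZero_id_one : IsDegreeZero (𝟙 (shifted (one 2) 0)) := by
  rw [shifted, ← emb.map_id, ← cls_nil]
  exact isDegreeZero_emb (cls_mem_degreeZero rfl)

theorem dotDiff_mem (k : ℕ) :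
    dotDiff k ∈ degreeZero (obj e₁ (qdeg k)) (obj e₁ (qdeg (k + 1))) := by
  have cls_mem : ∀ m : Movie e₁ e₁, m.degree = -2 →
      cls (qdeg k) (qdeg (k + 1)) m ∈ degreeZero (obj e₁ (qdeg k)) (obj e₁ (qdeg (k + 1))) :=
    fun m hm => cls_mem_degreeZero (by rw [hm, qdeg, qdeg]; push_cast; ring)
  exact add_mem (cls_mem _ rfl) (zsmul_mem (cls_mem _ rfl) _)

theorem isDegreeZero_P₂_d (k : ℤ) : IsDegreeZero (P₂.d k (k + 1)) := by
  rw [P₂_d]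
  match k with
  | .ofNat 0 =>
    rw [P₂d_zero]
    exact isDegreeZero_emb (cls_mem_degreeZero rfl)
  | .ofNat (k + 1) =>
    rw [P₂d_succ]
    exact isDegreeZero_emb (dotDiff_mem k)
  | .negSucc k => exact fun i => i.elim

theorem circleDeath_mem {p q : ℤ} (h : p = q + 1) :
    cls p q circleDeath ∈ degreeZero (obj (e₁.tensor e₁) p) (obj e₁ q) :=
  cls_mem_degreeZero (by rw [h]; change (1 : ℤ) + _ = 0; ring)

theorem circleSwap_mem {p q : ℤ} (h : p = q + 2) :
    cls p q circleSwap ∈ degreeZero (obj (e₁.tensor e₁) p) (obj (e₁.tensor e₁) q) :=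
  cls_mem_degreeZero (by rw [h]; change (2 : ℤ) + _ = 0; ring)

/-! ### Contracting homotopies -/

theorem contractible_of_homotopy (C : Cpx n) (h : ∀ k, C.X (k + 1) ⟶ C.X k)
    (hdeg : ∀ k, IsDegreeZero (h k))
    (hcomm : ∀ k, C.d (k + 1) (k + 1 + 1) ≫ h (k + 1) + h k ≫ C.d k (k + 1) = 𝟙 _) :
    Contractible C := by
  let h' : ∀ i j, (ComplexShape.up ℤ).Rel j i → (C.X i ⟶ C.X j) := fun _ j r =>
    eqToHom (congrArg C.X (Eq.symm r)) ≫ h j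
  have h'_eq : ∀ j r, h' (j + 1) j r = h j := fun _ _ => Category.id_comp _
  have id_eq : 𝟙 C = Homotopy.nullHomotopicMap' h' := by
    ext1 k
    obtain ⟨k, rfl⟩ : ∃ j, k = j + 1 := ⟨k - 1, by ring⟩
    have r₁ : (ComplexShape.up ℤ).Rel k (k + 1) := rfl
    have r₂ : (ComplexShape.up ℤ).Rel (k + 1) (k + 1 + 1) := rfl
    rw [Homotopy.nullHomotopicMap'_f r₁ r₂, h'_eq k r₁, h'_eq (k + 1) r₂, hcomm]
    rfl
  rw [Contractible, id_eq]
  refine ⟨Homotopy.nullHomotopy' h', fun i j => ?_⟩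
  by_cases r : (ComplexShape.up ℤ).Rel j i
  · have r' : j + 1 = i := r
    subst r'
    have hom_eq : (Homotopy.nullHomotopy' h').hom (j + 1) j = h j := (dif_pos r).trans (h'_eq j r)
    rw [hom_eq]
    exact hdeg j
  · rw [(Homotopy.nullHomotopy' h').zero i j r]
    exact fun _ _ => zero_mem _

section Map

variable (F : Cob 2 ⥤ Cob 2)
  (h₀ : F.obj (obj e₁ (qdeg 0)) ⟶ F.obj (obj (one 2) 0))
  (h : ∀ k, F.obj (obj e₁ (qdeg (k + 1))) ⟶ F.obj (obj e₁ (qdeg k)))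

/-- The matrices that `h₀` and `h` define between the chain groups of `P₂`, after applying the
functor `F`. -/
def mapHomotopy [F.Additive] : ∀ k : ℤ, F.mapMat_.obj (P₂X (k + 1)) ⟶ F.mapMat_.obj (P₂X k)
  | .ofNat 0 => emb.map h₀
  | .ofNat (k + 1) => emb.map (h k)
  | .negSucc _ => 0

variable {F h₀ h} [F.Additive]

theorem isDegreeZero_mapHomotopy (hdeg₀ : h₀ ∈ degreeZero _ _) (hdeg : ∀ k, h k ∈ degreeZero _ _)
    (k : ℤ) : IsDegreeZero (mapHomotopy F h₀ h k) := by
  match k with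
  | .ofNat 0 => exact isDegreeZero_emb hdeg₀
  | .ofNat (k + 1) => exact isDegreeZero_emb (hdeg k)
  | .negSucc k => exact fun _ j => j.elim

theorem map_P₂d_zero : F.mapMat_.map (P₂d (.ofNat 0)) = emb.map (F.map saddleDiff) :=
  congrArg F.mapMat_.map P₂d_zero

theorem map_P₂d_succ (k : ℕ) : F.mapMat_.map (P₂d (.ofNat (k + 1))) = emb.map (F.map (dotDiff k)) :=
  congrArg F.mapMat_.map (P₂d_succ k)

theorem mapHomotopy_comm (hcomm₀ : F.map saddleDiff ≫ h₀ = 𝟙 _)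
    (hcomm₁ : F.map (dotDiff 0) ≫ h 0 + h₀ ≫ F.map saddleDiff = 𝟙 _)
    (hcomm : ∀ k, F.map (dotDiff (k + 1)) ≫ h (k + 1) + h k ≫ F.map (dotDiff k) = 𝟙 _) (k : ℤ) :
    F.mapMat_.map (P₂d (k + 1)) ≫ mapHomotopy F h₀ h (k + 1) +
      mapHomotopy F h₀ h k ≫ F.mapMat_.map (P₂d k) = 𝟙 _ := by
  match k with
  | .ofNat 0 =>
    have H := congrArg emb.map hcomm₁
    rw [Functor.map_add, Functor.map_comp, Functor.map_comp, emb.map_id, ← map_P₂d_zero,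
      ← map_P₂d_succ] at H
    exact H
  | .ofNat (k + 1) =>
    have H := congrArg emb.map (hcomm k)
    rw [Functor.map_add, Functor.map_comp, Functor.map_comp, emb.map_id, ← map_P₂d_succ,
      ← map_P₂d_succ] at H
    exact H
  | .negSucc 0 =>
    have H := congrArg emb.map hcomm₀
    rw [Functor.map_comp, emb.map_id, ← map_P₂d_zero] at H
    have homotopy_zero : mapHomotopy F h₀ h (.negSucc 0) = 0 := rfl
    rw [homotopy_zero, zero_comp, add_zero]
    exact H
  | .negSucc (k + 1) => exact funext fun i => i.elim

theorem contractible_map (hdeg₀ : h₀ ∈ degreeZero _ _) (hdeg : ∀ k, h k ∈ degreeZero _ _)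
    (hcomm₀ : F.map saddleDiff ≫ h₀ = 𝟙 _)
    (hcomm₁ : F.map (dotDiff 0) ≫ h 0 + h₀ ≫ F.map saddleDiff = 𝟙 _)
    (hcomm : ∀ k, F.map (dotDiff (k + 1)) ≫ h (k + 1) + h k ≫ F.map (dotDiff k) = 𝟙 _) :
    Contractible ((F.mapMat_.mapHomologicalComplex _).obj P₂) := by
  refine contractible_of_homotopy _ (mapHomotopy F h₀ h) (isDegreeZero_mapHomotopy hdeg₀ hdeg)
    fun k => ?_
  rw [Functor.mapHomologicalComplex_obj_d, Functor.mapHomologicalComplex_obj_d, P₂_d, P₂_d]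
  exact mapHomotopy_comm hcomm₀ hcomm₁ hcomm k

theorem map_dotDiff (k : ℕ) :
    F.map (dotDiff k) = F.map (cls _ _ dotTop) + sign k • F.map (cls _ _ dotBot) := by
  rw [dotDiff, F.map_add, F.map_zsmul]

end Map

theorem tensorLeft_saddleDiff : (Cob.tensorLeft ⟨e₁, 0⟩).map saddleDiff =
    cls (0 + 0) (0 + qdeg 0) botArc.split :=
  tensorLeft_cls _ _ _ _

theorem tensorLeft_dotDiff (k : ℕ) : (Cob.tensorLeft ⟨e₁, 0⟩).map (dotDiff k) =
    cls (0 + qdeg k) (0 + qdeg (k + 1)) circleDot +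
      sign k • cls (0 + qdeg k) (0 + qdeg (k + 1)) botArc.dot₂ := by
  rw [map_dotDiff, tensorLeft_cls, tensorLeft_cls]
  rfl

theorem tensorRight_saddleDiff : (Cob.tensorRight ⟨e₁, 0⟩).map saddleDiff =
    cls (0 + 0) (qdeg 0 + 0) topArc.split :=
  tensorRight_cls _ _ _ _

theorem tensorRight_dotDiff (k : ℕ) : (Cob.tensorRight ⟨e₁, 0⟩).map (dotDiff k) =
    cls (qdeg k + 0) (qdeg (k + 1) + 0) topArc.dot₂ +
      sign k • cls (qdeg k + 0) (qdeg (k + 1) + 0) circleDot := by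
  rw [map_dotDiff, tensorRight_cls, tensorRight_cls]
  rfl

theorem qdeg_succ (k : ℕ) : qdeg (k + 1) = qdeg k + 2 := by
  rw [qdeg, qdeg]
  push_cast
  ring

theorem contractible_tensorLeft : Contractible (tensorLeft e₁ P₂) := by
  refine contractible_map (F := Cob.tensorLeft ⟨e₁, 0⟩)
    (h₀ := cls (0 + qdeg 0) (0 + 0) circleDeath)
    (h := fun k => cls (0 + qdeg (k + 1)) (0 + qdeg k) circleSwap)
    (circleDeath_mem rfl) (fun k => circleSwap_mem
      (p := 0 + qdeg (k + 1)) (q := 0 + qdeg k) (by rw [qdeg_succ, add_assoc]))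
    ?_ ?_ fun k => ?_
  · rw [tensorLeft_saddleDiff]
    exact (cls_comp _ _ _ _ _).trans ((botArc.cls_split_death _ _).trans (cls_nil _))
  · rw [tensorLeft_saddleDiff, tensorLeft_dotDiff, sign_zero]
    exact botArc.death_homotopy _ _ _
  · rw [tensorLeft_dotDiff, tensorLeft_dotDiff, sign_succ]
    exact botArc.swap_homotopy _ _ _ _

theorem contractible_tensorRight : Contractible (tensorRight P₂ e₁) := by
  refine contractible_map (F := Cob.tensorRight ⟨e₁, 0⟩)
    (h₀ := cls (qdeg 0 + 0) (0 + 0) circleDeath)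
    (h := fun k => sign k • cls (qdeg (k + 1) + 0) (qdeg k + 0) circleSwap)
    (circleDeath_mem rfl) (fun k => zsmul_mem (circleSwap_mem
      (p := qdeg (k + 1) + 0) (q := qdeg k + 0) (by rw [qdeg_succ, add_right_comm])) _)
    ?_ ?_ fun k => ?_
  · rw [tensorRight_saddleDiff]
    exact (cls_comp _ _ _ _ _).trans ((topArc.cls_split_death _ _).trans (cls_nil _))
  · rw [tensorRight_saddleDiff, tensorRight_dotDiff, sign_zero]
    exact topArc.neg_death_homotopy _ _ _
  · rw [tensorRight_dotDiff, tensorRight_dotDiff, sign_succ]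
    exact topArc.zsmul_swap_homotopy (sign_mul_self k) _ _ _

/-! ### The identity diagram is not a summand -/

theorem not_iso_one_biprod {a : Diagram n} {i j : Fin n} (hij : i ≠ j)
    (ha : a.Joined (a.firstPt i) (a.firstPt j)) (p q : ℤ) (D : Mat_ (Cob n)) :
    ¬ Nonempty (shifted a q ≅ shifted (one n) p ⊞ D) := by
  rintro ⟨φ⟩
  have split : (biprod.inl ≫ φ.inv) ≫ (φ.hom ≫ biprod.fst) = 𝟙 (shifted (one n) p) := by
    simp only [Category.assoc, Iso.inv_hom_id_assoc, biprod.inl_fst]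
  apply Cob.comp_ne_id hij ha p q (emb.preimage (biprod.inl ≫ φ.inv))
    (emb.preimage (φ.hom ≫ biprod.fst))
  apply emb.map_injective
  rw [emb.map_comp, emb.map_preimage, emb.map_preimage, emb.map_id]
  exact split

theorem e₁_joined : e₁.Joined (e₁.firstPt 0) (e₁.firstPt 1) := ⟨0, .cup 0, rfl, .cup_turn 0⟩

theorem P₂X_not_iso {k : ℤ} (hk : 0 < k) (D : Mat_ (Cob 2)) :
    ¬ Nonempty (P₂X k ≅ shifted (one 2) 0 ⊞ D) := by
  match k, hk with
  | .ofNat (k + 1), _ => exact not_iso_one_biprod zero_ne_one e₁_joined 0 _ D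

end BarNatan

theorem theorem4p2 :
    ∃ h : ∀ k : ℤ, BarNatan.P₂d k ≫ BarNatan.P₂d (k + 1) = 0,
      BarNatan.IsUniversalProjector (CochainComplex.of BarNatan.P₂X BarNatan.P₂d h) := by
  have universal : BarNatan.IsUniversalProjector BarNatan.P₂ := {
    inKom := ⟨0, fun _ => BarNatan.isZero_P₂X⟩
    isZero_of_neg := fun _ => BarNatan.isZero_P₂X
    deg_nonneg := fun _ => BarNatan.deg_P₂X_nonneg
    d_degreeZero := BarNatan.isDegreeZero_P₂_d
    zero_iso := ⟨Iso.refl _, BarNatan.isDegreeZero_id_one, BarNatan.isDegreeZero_id_one⟩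
    not_iso := fun _ => BarNatan.P₂X_not_iso
    tensor_e := fun i h => by
      obtain rfl : i = 0 := by omega
      exact BarNatan.contractible_tensorRight
    e_tensor := fun i h => by
      obtain rfl : i = 0 := by omega
      exact BarNatan.contractible_tensorLeft }
  exact ⟨BarNatan.P₂d_comp, universal⟩

end
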